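/- Let $M$ be a compact complex manifold of complex dimension $n\ge 2$ with a Hermitian metric, i.e. a smooth Riemannian metric $g$ with $g(JX,JY)=g(X,Y)$, and let $\omega(X,Y)=g(JX,Y)$ be its fundamental form, so that $\omega=\sqrt{-1}\,h_{i\bar j}\,dz^i\wedge d\bar z^j$ in local holomorphic coordinates, where $h_{i\bar j}=g(\partial/\partial z^i,\partial/\partial\bar z^j)$ ($g$ extended complex bilinearly). Let $(h^{i\bar j})$ be the transposed inverse of $(h_{i\bar j})$ and $$\Gamma_{ij}^k=h^{k\bar l}\partial_i h_{j\bar l},\qquad R_{i\bar jk\bar l}=-h_{p\bar l}\,\partial_{\bar j}\Gamma_{ik}^p$$ the Christoffel symbols and the curvature of the Chern connection (summation convention). The first and second Chern-Ricci forms are $\rho^{(a)}=\sqrt{-1}\rho^{(a)}_{i\bar j}dz^i\wedge d\bar z^j$, $a=1,2$, with $$\rho^{(1)}_{i\bar j}=h^{k\bar l}R_{i\bar jk\bar l},\qquad \rho^{(2)}_{i\bar j}=h^{k\bar l}R_{k\bar li\bar j},$$ and the scalar curvatures are $s=h^{i\bar j}h^{k\bar l}R_{i\bar jk\bar l}$ and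 $\hat s=h^{i\bar l}h^{k\bar j}R_{i\bar jk\bar l}$. Let $(\varphi,\psi)=\int_M\langle\varphi,\psi\rangle\,\omega^n/n!$ be the $L^2$ inner product of forms. There are a unique smooth $(0,1)$-form $\partial^*\omega$ with $(\partial\varphi,\omega)=(\varphi,\partial^*\omega)$ for all smooth $(0,1)$-forms $\varphi$, and a unique smooth $(1,0)$-form $\bar\partial^*\omega$ with $(\bar\partial\varphi,\omega)=(\varphi,\bar\partial^*\omega)$ for all smooth $(1,0)$-forms $\varphi$. Moreover: (1) If $\omega$ is locally conformally Kähler, i.e. there is a smooth closed real 1-form $\theta$ with $d\omega=\theta\wedge\omega$, then $$\rho^{(1)}-\rho^{(2)}=\frac{1}{n-1}\bigl((\hat s-s)\,\omega+n\,\partial\partial^*\omega\bigr).$$ (2) If $n=2$ (i.e. $M$ is a compact Hermitian surface, not necessarily locally conformally Kähler), then $$\rho^{(1)}-\rho^{(2)}=(\hat s-s)\,\omega+\partial\partial^*\omega+\bar\partial\bar\partial^*\omega.$$ -/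

import Mathlib

open scoped Manifold ContDiff ComplexConjugate
open MeasureTheory

noncomputable section

namespace HermGeom

/-- The model space `ℂⁿ` of an `n`-dimensional complex manifold. -/
abbrev Cn (n : ℕ) : Type := Fin n → ℂ

/-- The tangent space of the complex manifold `M` at `p`: a complex vector space, the complex
structure `J` being multiplication by `Complex.I`. Its underlying real vector space is the usual
real tangent space of dimension `2 n`. -/
abbrev T (n : ℕ) {M : Type*} [TopologicalSpace M] [ChartedSpace (Cn n) M] (p : M) : Type :=
  TangentSpace 𝓘(ℂ, Cn n) p

/-- The local holomorphic coordinate systems of `M`: the charts of the maximal holomorphic atlas. -/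
def coords (n : ℕ) (M : Type*) [TopologicalSpace M] [ChartedSpace (Cn n) M] :
    Set (OpenPartialHomeomorph M (Cn n)) :=
  IsManifold.maximalAtlas 𝓘(ℂ, Cn n) ω M

section Local

variable {n : ℕ}

/-- The `i`-th standard basis vector of `ℂⁿ`, i.e. `∂/∂xⁱ` for `zⁱ = xⁱ + √-1 yⁱ`;
`∂/∂yⁱ` is `Complex.I • dx i`. -/
def dx (i : Fin n) : Cn n := Pi.single i 1

/-- The Wirtinger derivative `∂f/∂zⁱ = ½ (∂f/∂xⁱ - √-1 ∂f/∂yⁱ)`. -/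
def wirt (i : Fin n) (f : Cn n → ℂ) (y : Cn n) : ℂ :=
  (1 / 2) * (fderiv ℝ f y (dx i) - Complex.I * fderiv ℝ f y (Complex.I • dx i))

/-- The Wirtinger derivative `∂f/∂z̄ⁱ = ½ (∂f/∂xⁱ + √-1 ∂f/∂yⁱ)`. -/
def wirtBar (i : Fin n) (f : Cn n → ℂ) (y : Cn n) : ℂ :=
  (1 / 2) * (fderiv ℝ f y (dx i) + Complex.I * fderiv ℝ f y (Complex.I • dx i))

/-- `B(∂/∂zⁱ, ∂/∂z̄ʲ)` for the complex bilinear extension of a real bilinear `B`, where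
`∂/∂zⁱ = ½ (∂/∂xⁱ - √-1 ∂/∂yⁱ)` and `∂/∂z̄ʲ = ½ (∂/∂xʲ + √-1 ∂/∂yʲ)`. -/
def mixedComp (B : Cn n → Cn n → ℂ) (i j : Fin n) : ℂ :=
  (1 / 4) * (B (dx i) (dx j) + Complex.I * B (dx i) (Complex.I • dx j)
    - Complex.I * B (Complex.I • dx i) (dx j) + B (Complex.I • dx i) (Complex.I • dx j))

end Local

section Forms

variable {n : ℕ} {M : Type*} [TopologicalSpace M] [ChartedSpace (Cn n) M]

/-- The differential at `y` of the inverse `ℂⁿ → M` of a chart. -/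
def frame (e : OpenPartialHomeomorph M (Cn n)) (y : Cn n) : Cn n →L[ℂ] T n (e.symm y) :=
  mfderiv 𝓘(ℂ, Cn n) 𝓘(ℂ, Cn n) e.symm y

variable (n M) in
/-- Not necessarily smooth `k`-forms on `M` with values in `𝕂` (which is `ℝ` or `ℂ`). -/
abbrev Form (𝕂 : Type*) [NormedAddCommGroup 𝕂] [NormedSpace ℝ 𝕂] (k : ℕ) : Type _ :=
  (p : M) → T n p [⋀^Fin k]→L[ℝ] 𝕂

/-- The expression of a form in a chart, i.e. its pull-back to `ℂⁿ` by the inverse of the chart. -/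
def Form.rep {𝕂 : Type*} [NormedAddCommGroup 𝕂] [NormedSpace ℝ 𝕂] {k : ℕ} (α : Form n M 𝕂 k)
    (e : OpenPartialHomeomorph M (Cn n)) (y : Cn n) : Cn n [⋀^Fin k]→L[ℝ] 𝕂 :=
  (α (e.symm y)).compContinuousLinearMap ((frame e y).restrictScalars ℝ)

/-- Smooth (`C^∞` in the real sense) forms. -/
def Form.Smooth {𝕂 : Type*} [NormedAddCommGroup 𝕂] [NormedSpace ℝ 𝕂] {k : ℕ}
    (α : Form n M 𝕂 k) : Prop :=
  ∀ e ∈ coords n M, ContDiffOn ℝ ∞ (α.rep e) e.target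

/-- A smooth form of type `(1,0)`. -/
def Form.IsSmooth10 (α : Form n M ℂ 1) : Prop :=
  α.Smooth ∧ ∀ (p : M) (v : T n p), α p ![Complex.I • v] = Complex.I * α p ![v]

/-- A smooth form of type `(0,1)`. -/
def Form.IsSmooth01 (α : Form n M ℂ 1) : Prop :=
  α.Smooth ∧ ∀ (p : M) (v : T n p), α p ![Complex.I • v] = -(Complex.I * α p ![v])

/-- The coefficient `α_i = α(∂/∂zⁱ)` of `dzⁱ` in a complex 1-form. -/
def Form.coeff (α : Form n M ℂ 1) (e : OpenPartialHomeomorph M (Cn n)) (y : Cn n) (i : Fin n) :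
    ℂ :=
  (1 / 2) * (α.rep e y ![dx i] - Complex.I * α.rep e y ![Complex.I • dx i])

/-- The coefficient `α_j̄ = α(∂/∂z̄ʲ)` of `dz̄ʲ` in a complex 1-form. -/
def Form.coeffBar (α : Form n M ℂ 1) (e : OpenPartialHomeomorph M (Cn n)) (y : Cn n) (j : Fin n) :
    ℂ :=
  (1 / 2) * (α.rep e y ![dx j] + Complex.I * α.rep e y ![Complex.I • dx j])

/-- The coefficient `ψ_{ij̄} = ψ(∂/∂zⁱ, ∂/∂z̄ʲ)` of `dzⁱ ∧ dz̄ʲ` in a complex 2-form. -/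
def Form.coeff11 (ψ : Form n M ℂ 2) (e : OpenPartialHomeomorph M (Cn n)) (y : Cn n)
    (i j : Fin n) : ℂ :=
  mixedComp (fun u v => ψ.rep e y ![u, v]) i j

/-- The coefficient of `dzⁱ ∧ dz̄ʲ` in `∂α`, for `α = α_j̄ dz̄ʲ` of type `(0,1)`:
`∂α = (∂α_j̄/∂zⁱ) dzⁱ ∧ dz̄ʲ`. -/
def Form.del (α : Form n M ℂ 1) (e : OpenPartialHomeomorph M (Cn n)) (y : Cn n)
    (i j : Fin n) : ℂ :=
  wirt i (fun x => α.coeffBar e x j) y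

/-- The coefficient of `dzⁱ ∧ dz̄ʲ` in `∂̄α`, for `α = α_i dzⁱ` of type `(1,0)`:
`∂̄α = (∂α_i/∂z̄ʲ) dz̄ʲ ∧ dzⁱ`. -/
def Form.delBar (α : Form n M ℂ 1) (e : OpenPartialHomeomorph M (Cn n)) (y : Cn n)
    (i j : Fin n) : ℂ :=
  -wirtBar j (fun x => α.coeff e x i) y

end Forms

/-- A Hermitian metric on the complex manifold `M`: a smooth Riemannian metric `g` with
`g(JX, JY) = g(X, Y)`. -/
structure HermitianMetric (n : ℕ) (M : Type*) [TopologicalSpace M] [ChartedSpace (Cn n) M] where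
  g : (p : M) → T n p →L[ℝ] T n p →L[ℝ] ℝ
  symm : ∀ (p : M) (v w : T n p), g p v w = g p w v
  pos : ∀ (p : M) (v : T n p), v ≠ 0 → 0 < g p v v
  map_J : ∀ (p : M) (v w : T n p), g p (Complex.I • v) (Complex.I • w) = g p v w
  smooth : ∀ e ∈ coords n M, ∀ v w : Cn n,
    ContDiffOn ℝ ∞ (fun y => g (e.symm y) (frame e y v) (frame e y w)) e.target

namespace HermitianMetric

variable {n : ℕ} {M : Type*} [TopologicalSpace M] [ChartedSpace (Cn n) M]

/-- The fundamental form `ω(X, Y) = g(JX, Y)`, as a complex-valued 2-form. -/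
def fund (G : HermitianMetric n M) : Form n M ℂ 2 := fun p =>
  { toFun := fun v => ((G.g p (Complex.I • v 0) (v 1) : ℝ) : ℂ)
    map_update_add' := by
      intro _ m i x y
      fin_cases i <;> simp [Function.update]
    map_update_smul' := by
      intro _ m i c x
      fin_cases i
      · simp [Function.update, smul_comm Complex.I c x]
      · simp [Function.update]
    cont := by
      have h1 : Continuous fun v : Fin 2 → Cn n =>
          (show Cn n →L[ℝ] Cn n →L[ℝ] ℝ from G.g p) (Complex.I • v 0) (v 1) := by
        fun_prop
      exact Complex.continuous_ofReal.comp h1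
    map_eq_zero_of_eq' := by
      intro v i j hij hne
      have h01 : v 0 = v 1 := by
        fin_cases i <;> fin_cases j <;> simp_all
      have h := G.map_J p (Complex.I • v 1) (v 1)
      rw [smul_smul, Complex.I_mul_I, neg_one_smul, map_neg, _root_.neg_apply,
        G.symm p (v 1)] at h
      have h0 : G.g p (Complex.I • v 1) (v 1) = 0 := by linarith
      simp [h01, h0] }

/-- `h_{ij̄} = h(∂/∂zⁱ, ∂/∂z̄ʲ)`, with `h` the complex bilinear extension of `g`. -/
def h (G : HermitianMetric n M) (e : OpenPartialHomeomorph M (Cn n)) (y : Cn n) :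
    Matrix (Fin n) (Fin n) ℂ :=
  Matrix.of fun i j =>
    mixedComp (fun u v => ((G.g (e.symm y) (frame e y u) (frame e y v) : ℝ) : ℂ)) i j

/-- `h^{ij̄}`, the transposed inverse matrix: `∑_j h^{ij̄} h_{kj̄} = δ_{ik}`. -/
def hInv (G : HermitianMetric n M) (e : OpenPartialHomeomorph M (Cn n)) (y : Cn n)
    (i j : Fin n) : ℂ :=
  (G.h e y)⁻¹ j i

/-! ### Chern connection and curvature -/

/-- The Christoffel symbols `Γ_{ij}^k = h^{kl̄} ∂_i h_{jl̄}` of the Chern connection (the connection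
with `∇J = 0`, `∇h = 0` and torsion without `(1,1)`-part) in holomorphic coordinates:
`∇_{∂_i} ∂_j = Γ_{ij}^k ∂_k` and `∇_{∂_ī} ∂_j = 0`. -/
def Γ (G : HermitianMetric n M) (e : OpenPartialHomeomorph M (Cn n)) (y : Cn n)
    (i j k : Fin n) : ℂ :=
  ∑ l, G.hInv e y k l * wirt i (fun x => G.h e x j l) y

/-- The Chern curvature `R_{ij̄kl̄} = - h_{pl̄} ∂_{j̄} Γ_{ik}^p`. -/
def R (G : HermitianMetric n M) (e : OpenPartialHomeomorph M (Cn n)) (y : Cn n)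
    (i j k l : Fin n) : ℂ :=
  -∑ p, G.h e y p l * wirtBar j (fun x => G.Γ e x i k p) y

/-- The coefficient `√-1 ρ⁽¹⁾_{ij̄}` of `dzⁱ ∧ dz̄ʲ` in the first Chern-Ricci form, where
`ρ⁽¹⁾_{ij̄} = h^{kl̄} R_{ij̄kl̄}`. -/
def ricci1 (G : HermitianMetric n M) (e : OpenPartialHomeomorph M (Cn n)) (y : Cn n)
    (i j : Fin n) : ℂ :=
  Complex.I * ∑ k, ∑ l, G.hInv e y k l * G.R e y i j k l

/-- The coefficient `√-1 ρ⁽²⁾_{ij̄}` of `dzⁱ ∧ dz̄ʲ` in the second Chern-Ricci form, where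
`ρ⁽²⁾_{ij̄} = h^{kl̄} R_{kl̄ij̄}`. -/
def ricci2 (G : HermitianMetric n M) (e : OpenPartialHomeomorph M (Cn n)) (y : Cn n)
    (i j : Fin n) : ℂ :=
  Complex.I * ∑ k, ∑ l, G.hInv e y k l * G.R e y k l i j

/-- The Chern scalar curvature `s = h^{ij̄} h^{kl̄} R_{ij̄kl̄}`. -/
def scal (G : HermitianMetric n M) (e : OpenPartialHomeomorph M (Cn n)) (y : Cn n) : ℂ :=
  ∑ i, ∑ j, ∑ k, ∑ l, G.hInv e y i j * G.hInv e y k l * G.R e y i j k l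

/-- The scalar curvature `ŝ = h^{il̄} h^{kj̄} R_{ij̄kl̄}`. -/
def scalHat (G : HermitianMetric n M) (e : OpenPartialHomeomorph M (Cn n)) (y : Cn n) : ℂ :=
  ∑ i, ∑ j, ∑ k, ∑ l, G.hInv e y i l * G.hInv e y k j * G.R e y i j k l

/-! ### Locally conformally Kähler metrics -/

/-- The metric is locally conformally Kähler: there is a smooth closed real 1-form `θ` with
`dω = θ ∧ ω`. -/
def IsLCK (G : HermitianMetric n M) : Prop :=
  ∃ θ : Form n M ℝ 1, θ.Smooth ∧ ∀ e ∈ coords n M, ∀ y ∈ e.target,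
    extDeriv (θ.rep e) y = 0 ∧
    ∀ u v w : Cn n, extDeriv (G.fund.rep e) y ![u, v, w] =
      (θ.rep e y ![u] : ℂ) * G.fund.rep e y ![v, w]
        - (θ.rep e y ![v] : ℂ) * G.fund.rep e y ![u, w]
        + (θ.rep e y ![w] : ℂ) * G.fund.rep e y ![u, v]

/-! ### Inner products and formal adjoints -/

/-- The inner product `⟨φ, ψ⟩ = h^{ij̄} φ_i conj(ψ_j)` of `(1,0)`-covectors. -/
def inner10 (G : HermitianMetric n M) (e : OpenPartialHomeomorph M (Cn n)) (y : Cn n)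
    (a b : Fin n → ℂ) : ℂ :=
  ∑ i, ∑ j, G.hInv e y i j * a i * conj (b j)

/-- The inner product `⟨φ, ψ⟩ = h^{kl̄} φ_l̄ conj(ψ_k̄)` of `(0,1)`-covectors. -/
def inner01 (G : HermitianMetric n M) (e : OpenPartialHomeomorph M (Cn n)) (y : Cn n)
    (a b : Fin n → ℂ) : ℂ :=
  ∑ k, ∑ l, G.hInv e y k l * a l * conj (b k)

/-- The inner product `⟨φ, ψ⟩ = h^{ij̄} h^{kl̄} φ_{il̄} conj(ψ_{jk̄})` of `(1,1)`-covectors. -/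
def inner11 (G : HermitianMetric n M) (e : OpenPartialHomeomorph M (Cn n)) (y : Cn n)
    (A B : Fin n → Fin n → ℂ) : ℂ :=
  ∑ i, ∑ j, ∑ k, ∑ l, G.hInv e y i j * G.hInv e y k l * A i l * conj (B j k)

variable [MeasurableSpace M]

/-- The volume measure on the domain of a chart: `dv = ωⁿ / n!` is
`2ⁿ det(h_{ij̄}) dx¹ dy¹ ⋯ dxⁿ dyⁿ`. -/
def chartVol (G : HermitianMetric n M) (e : OpenPartialHomeomorph M (Cn n)) : Measure M :=
  ((volume.restrict e.target).withDensity
    fun y => ENNReal.ofReal (2 ^ n * (G.h e y).det.re)).map e.symm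

/-- The volume measure `dv` of `M`: the smallest measure that is at least the volume measure of
each chart domain. As these agree on overlaps, it restricts to each of them. -/
def vol (G : HermitianMetric n M) : Measure M :=
  ⨆ e ∈ coords n M, G.chartVol e

/-- `(φ, ψ) = ∫_M ⟨φ, ψ⟩ dv` for `(1,0)`-forms. Pointwise inner products do not depend on the
holomorphic coordinates; at `p` they are computed here in the preferred chart around `p`. -/
def l2Inner10 (G : HermitianMetric n M) (φ ψ : Form n M ℂ 1) : ℂ :=
  ∫ p, G.inner10 (chartAt (Cn n) p) (chartAt (Cn n) p p)
    (φ.coeff (chartAt (Cn n) p) (chartAt (Cn n) p p))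
    (ψ.coeff (chartAt (Cn n) p) (chartAt (Cn n) p p)) ∂G.vol

/-- `(φ, ψ) = ∫_M ⟨φ, ψ⟩ dv` for `(0,1)`-forms. -/
def l2Inner01 (G : HermitianMetric n M) (φ ψ : Form n M ℂ 1) : ℂ :=
  ∫ p, G.inner01 (chartAt (Cn n) p) (chartAt (Cn n) p p)
    (φ.coeffBar (chartAt (Cn n) p) (chartAt (Cn n) p p))
    (ψ.coeffBar (chartAt (Cn n) p) (chartAt (Cn n) p p)) ∂G.vol

/-- `(Φ, Ψ) = ∫_M ⟨Φ, Ψ⟩ dv` for `(1,1)`-forms that are given by their coefficients in charts. -/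
def l2Inner11 (G : HermitianMetric n M)
    (Φ Ψ : OpenPartialHomeomorph M (Cn n) → Cn n → Fin n → Fin n → ℂ) : ℂ :=
  ∫ p, G.inner11 (chartAt (Cn n) p) (chartAt (Cn n) p p)
    (Φ (chartAt (Cn n) p) (chartAt (Cn n) p p))
    (Ψ (chartAt (Cn n) p) (chartAt (Cn n) p p)) ∂G.vol

/-- `α = ∂*ψ` for the `(1,1)`-form `ψ`: `α` is a smooth `(0,1)`-form and `(∂φ, ψ) = (φ, α)` for
all smooth `(0,1)`-forms `φ`. -/
def IsDelStar (G : HermitianMetric n M) (ψ : Form n M ℂ 2) (α : Form n M ℂ 1) : Prop :=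
  α.IsSmooth01 ∧ ∀ φ : Form n M ℂ 1, φ.IsSmooth01 →
    G.l2Inner11 φ.del ψ.coeff11 = G.l2Inner01 φ α

/-- `α = ∂̄*ψ` for the `(1,1)`-form `ψ`: `α` is a smooth `(1,0)`-form and `(∂̄φ, ψ) = (φ, α)` for
all smooth `(1,0)`-forms `φ`. -/
def IsDelBarStar (G : HermitianMetric n M) (ψ : Form n M ℂ 2) (α : Form n M ℂ 1) : Prop :=
  α.IsSmooth10 ∧ ∀ φ : Form n M ℂ 1, φ.IsSmooth10 →
    G.l2Inner11 φ.delBar ψ.coeff11 = G.l2Inner10 φ α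

open Classical in
/-- `∂*ψ` for a `(1,1)`-form `ψ` (and `0` if there is no such form). -/
def delStar (G : HermitianMetric n M) (ψ : Form n M ℂ 2) : Form n M ℂ 1 :=
  if H : ∃ α, G.IsDelStar ψ α then H.choose else 0

open Classical in
/-- `∂̄*ψ` for a `(1,1)`-form `ψ` (and `0` if there is no such form). -/
def delBarStar (G : HermitianMetric n M) (ψ : Form n M ℂ 2) : Form n M ℂ 1 :=
  if H : ∃ α, G.IsDelBarStar ψ α then H.choose else 0

end HermitianMetric

end HermGeom

end

/-! Everything reduces to the torsion trace τ_k = T_{ka}^a of the Chern connection. Two facts about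
it carry the proof.

The analytic fact is ∂*ω = -√-1 τ̄ (`isDelStar_torsionForm`). Pointwise ⟨∂φ, ω⟩ = -√-1 h^{il̄} ∂_i
φ_l̄. Moving ∂_i onto the volume density costs ∂_i(h^{il̄} det h) = det h · h^{kl̄} τ_k
(`sum_wirt_hInv_mul_det`), so ⟨∂φ, ω⟩ - ⟨φ, -√-1 τ̄⟩ times the density is a coordinate divergence. A
partition of unity brings φ into one chart, where a compactly supported divergence integrates to
zero. Uniqueness of the adjoint is positivity of the L² product on the difference of two candidates,
and ∂̄*ω is the complex conjugate of ∂*ω.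

The curvature fact is ∂_j̄ τ_i = h^{kl̄}(R_{kj̄il̄} - R_{ij̄kl̄}) (`wirtBar_torsionTrace`). It
writes ∂∂*ω and ∂̄∂̄*ω as curvature contractions, so both formulas become pointwise algebra.

On a surface, R_{ij̄kl̄} + R_{kl̄ij̄} - R_{kj̄il̄} - R_{il̄kj̄} is antisymmetric in i, k and in j,
l. In dimension two such a tensor has a single component, and its trace is a multiple of h; taking a
second trace finds the factor (`ricci_sub_of_surface`).

In the locally conformally Kähler case, with a_i = θ(∂/∂zⁱ), the equation dω = θ ∧ ω gives T_{ik}^p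
= a_i δ_k^p - a_k δ_i^p. Then τ = (n-1)a, and the failure of R to be symmetric in i, k is expressed
by ∂_j̄ a_i. Closedness of θ makes the matrix ∂_j̄ a_i Hermitian, which handles the barred indices
too (`ricci_sub_of_lck`). -/

noncomputable section

namespace HermGeom

/-! ### Wirtinger calculus on ℂⁿ. -/

section Wirtinger

variable {n : ℕ} {f g : Cn n → ℂ} {y : Cn n} {U : Set (Cn n)}

theorem wirt_congr (i : Fin n) (h : f =ᶠ[nhds y] g) : wirt i f y = wirt i g y := by
  simp only [wirt, h.fderiv_eq]

theorem wirtBar_congr (i : Fin n) (h : f =ᶠ[nhds y] g) : wirtBar i f y = wirtBar i g y := by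
  simp only [wirtBar, h.fderiv_eq]

@[simp]
theorem wirt_const (i : Fin n) (c : ℂ) : wirt i (fun _ => c) y = 0 := by
  simp [wirt]

@[simp]
theorem wirtBar_const (i : Fin n) (c : ℂ) : wirtBar i (fun _ => c) y = 0 := by
  simp [wirtBar]

theorem wirt_add (i : Fin n) (hf : DifferentiableAt ℝ f y) (hg : DifferentiableAt ℝ g y) :
    wirt i (fun x => f x + g x) y = wirt i f y + wirt i g y := by
  simp only [wirt, fderiv_fun_add hf hg, _root_.add_apply]; ring

theorem wirt_mul (i : Fin n) (hf : DifferentiableAt ℝ f y) (hg : DifferentiableAt ℝ g y) :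
    wirt i (fun x => f x * g x) y = f y * wirt i g y + wirt i f y * g y := by
  simp only [wirt, fderiv_fun_mul hf hg, _root_.add_apply, _root_.smul_apply, smul_eq_mul]; ring

theorem wirt_const_mul (i : Fin n) (c : ℂ) (hf : DifferentiableAt ℝ f y) :
    wirt i (fun x => c * f x) y = c * wirt i f y := by
  rw [wirt_mul i (differentiableAt_const c) hf]; simp

theorem wirt_sum {ι : Type*} (s : Finset ι) (i : Fin n) {f : ι → Cn n → ℂ}
    (hf : ∀ a ∈ s, DifferentiableAt ℝ (f a) y) :
    wirt i (fun x => ∑ a ∈ s, f a x) y = ∑ a ∈ s, wirt i (f a) y := by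
  simp only [wirt, fderiv_fun_sum hf, _root_.sum_apply, Finset.mul_sum,
    ← Finset.sum_sub_distrib]

theorem fderiv_conj_apply (hf : DifferentiableAt ℝ f y) (v : Cn n) :
    fderiv ℝ (fun x => conj (f x)) y v = conj (fderiv ℝ f y v) := by
  have h : HasFDerivAt (fun x => conj (f x))
      ((Complex.conjCLE : ℂ →L[ℝ] ℂ).comp (fderiv ℝ f y)) y :=
    (Complex.conjCLE : ℂ →L[ℝ] ℂ).hasFDerivAt.comp y hf.hasFDerivAt
  rw [h.fderiv]; simp

theorem wirt_conj (i : Fin n) (hf : DifferentiableAt ℝ f y) :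
    wirt i (fun x => conj (f x)) y = conj (wirtBar i f y) := by
  simp only [wirt, wirtBar, fderiv_conj_apply hf, map_mul, map_add, map_div₀, map_one,
    map_ofNat, Complex.conj_I]
  ring

theorem wirtBar_conj (i : Fin n) (hf : DifferentiableAt ℝ f y) :
    wirtBar i (fun x => conj (f x)) y = conj (wirt i f y) := by
  simp only [wirt, wirtBar, fderiv_conj_apply hf, map_mul, map_sub, map_div₀, map_one,
    map_ofNat, Complex.conj_I]
  ring

theorem _root_.DifferentiableAt.conj_comp (hf : DifferentiableAt ℝ f y) :
    DifferentiableAt ℝ (fun x => conj (f x)) y :=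
  (Complex.conjCLE : ℂ →L[ℝ] ℂ).differentiableAt.comp y hf

theorem wirtBar_add (i : Fin n) (hf : DifferentiableAt ℝ f y) (hg : DifferentiableAt ℝ g y) :
    wirtBar i (fun x => f x + g x) y = wirtBar i f y + wirtBar i g y := by
  simp only [wirtBar, fderiv_fun_add hf hg, _root_.add_apply]; ring

theorem wirtBar_sub (i : Fin n) (hf : DifferentiableAt ℝ f y) (hg : DifferentiableAt ℝ g y) :
    wirtBar i (fun x => f x - g x) y = wirtBar i f y - wirtBar i g y := by
  simp only [wirtBar, fderiv_fun_sub hf hg, _root_.sub_apply]; ring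

theorem wirtBar_mul (i : Fin n) (hf : DifferentiableAt ℝ f y) (hg : DifferentiableAt ℝ g y) :
    wirtBar i (fun x => f x * g x) y = f y * wirtBar i g y + wirtBar i f y * g y := by
  simp only [wirtBar, fderiv_fun_mul hf hg, _root_.add_apply, _root_.smul_apply, smul_eq_mul]
  ring

theorem wirtBar_const_mul (i : Fin n) (c : ℂ) (hf : DifferentiableAt ℝ f y) :
    wirtBar i (fun x => c * f x) y = c * wirtBar i f y := by
  rw [wirtBar_mul i (differentiableAt_const c) hf]; simp

theorem wirtBar_sum {ι : Type*} (s : Finset ι) (i : Fin n) {f : ι → Cn n → ℂ}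
    (hf : ∀ a ∈ s, DifferentiableAt ℝ (f a) y) :
    wirtBar i (fun x => ∑ a ∈ s, f a x) y = ∑ a ∈ s, wirtBar i (f a) y := by
  simp only [wirtBar, fderiv_fun_sum hf, _root_.sum_apply, Finset.mul_sum,
    ← Finset.sum_add_distrib]

theorem contDiffOn_fderiv_apply (hU : IsOpen U) (hf : ContDiffOn ℝ ∞ f U) (v : Cn n) :
    ContDiffOn ℝ ∞ (fun x => fderiv ℝ f x v) U :=
  (hf.fderiv_of_isOpen hU (by simp)).clm_apply contDiffOn_const

theorem contDiffOn_wirt (hU : IsOpen U) (hf : ContDiffOn ℝ ∞ f U) (i : Fin n) :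
    ContDiffOn ℝ ∞ (wirt i f) U :=
  contDiffOn_const.mul ((contDiffOn_fderiv_apply hU hf _).sub
    (contDiffOn_const.mul (contDiffOn_fderiv_apply hU hf _)))

theorem contDiffOn_conj (hf : ContDiffOn ℝ ∞ f U) : ContDiffOn ℝ ∞ (fun x => conj (f x)) U :=
  (Complex.conjCLE : ℂ →L[ℝ] ℂ).contDiff.comp_contDiffOn hf

theorem _root_.ContDiffOn.differentiableAt_of_isOpen {E F : Type*} [NormedAddCommGroup E]
    [NormedSpace ℝ E] [NormedAddCommGroup F] [NormedSpace ℝ F] {f : E → F} {U : Set E}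
    (hf : ContDiffOn ℝ ∞ f U) (hU : IsOpen U) {y : E} (hy : y ∈ U) : DifferentiableAt ℝ f y :=
  (hf.differentiableOn (by simp)).differentiableAt (hU.mem_nhds hy)

/-- Both sides expand into real second derivatives, which are symmetric. -/
theorem wirtBar_wirt_comm (hU : IsOpen U) (hf : ContDiffOn ℝ ∞ f U) (hy : y ∈ U) (i j : Fin n) :
    wirtBar j (wirt i f) y = wirt i (wirtBar j f) y := by
  have hs : IsSymmSndFDerivAt ℝ f y :=
    (hf.contDiffAt (hU.mem_nhds hy)).isSymmSndFDerivAt (by simpa using WithTop.coe_le_coe.2 (le_top : (2 : ℕ∞) ≤ ⊤))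
  have hd : DifferentiableAt ℝ (fderiv ℝ f) y :=
    (hf.fderiv_of_isOpen (m := ∞) hU (by simp)).differentiableAt_of_isOpen hU hy
  have hv : ∀ v, DifferentiableAt ℝ (fun x => fderiv ℝ f x v) y := fun v =>
    hd.clm_apply (differentiableAt_const v)
  have he : ∀ v w, fderiv ℝ (fun x => fderiv ℝ f x v) y w = fderiv ℝ (fderiv ℝ f) y w v := by
    intro v w
    rw [fderiv_clm_apply hd (differentiableAt_const v)]; simp
  have hI : ∀ v, DifferentiableAt ℝ (fun x => Complex.I * fderiv ℝ f x v) y := fun v =>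
    (differentiableAt_const _).mul (hv v)
  have hfd : ∀ v w, fderiv ℝ (fun x => Complex.I * fderiv ℝ f x v) y w =
      Complex.I * fderiv ℝ (fderiv ℝ f) y w v := by
    intro v w
    rw [fderiv_const_mul (hv v), _root_.smul_apply, he, smul_eq_mul]
  unfold wirt wirtBar
  rw [fderiv_const_mul ((hv (dx i)).fun_sub (hI (Complex.I • dx i))),
    fderiv_const_mul ((hv (dx j)).fun_add (hI (Complex.I • dx j))),
    fderiv_fun_sub (hv _) (hI _), fderiv_fun_add (hv _) (hI _)]
  simp only [_root_.smul_apply, _root_.add_apply, _root_.sub_apply, hfd, he, smul_eq_mul]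
  rw [hs.eq (dx i) (dx j), hs.eq (dx i) (Complex.I • dx j), hs.eq (Complex.I • dx i) (dx j),
    hs.eq (Complex.I • dx i) (Complex.I • dx j)]
  ring

theorem eq_sum_smul_dx (w : Cn n) : w = ∑ a, w a • dx a := by
  ext i
  simp [dx, Finset.sum_apply, Pi.single_apply]

/-- A real linear function on `ℂⁿ` is the sum of a complex linear and an antilinear one. -/
theorem real_linear_apply (L : Cn n →L[ℝ] ℂ) (w : Cn n) :
    L w = ∑ a, ((1 / 2) * (L (dx a) - Complex.I * L (Complex.I • dx a)) * w a
      + (1 / 2) * (L (dx a) + Complex.I * L (Complex.I • dx a)) * conj (w a)) := by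
  conv_lhs => rw [eq_sum_smul_dx w, map_sum]
  refine Finset.sum_congr rfl fun a _ => ?_
  have h : w a • dx a = (w a).re • dx a + (w a).im • (Complex.I • dx a : Cn n) := by
    have h2 : w a • dx a = ((w a).re + (w a).im * Complex.I) • (dx a : Cn n) := by
      rw [Complex.re_add_im]
    rw [h2, add_smul, mul_smul]
    rfl
  rw [h, map_add, map_smul, map_smul]
  have h1 : w a = (w a).re + (w a).im * Complex.I := (Complex.re_add_im _).symm
  have h2 : conj (w a) = (w a).re - (w a).im * Complex.I := by
    apply Complex.ext <;> simp
  rw [h2]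
  conv_rhs => rw [show ∀ x y : ℂ, x * w a + y = x * ((w a).re + (w a).im * Complex.I) + y from
    fun x y => by rw [← h1]]
  simp only [Complex.real_smul]
  linear_combination ((w a).im * L (Complex.I • dx a)) * Complex.I_sq

theorem wirt_of_holomorphic (i : Fin n) (hf : DifferentiableAt ℂ f y) :
    wirt i f y = fderiv ℂ f y (dx i) := by
  simp only [wirt, hf.fderiv_restrictScalars ℝ, ContinuousLinearMap.coe_restrictScalars',
    map_smul, smul_eq_mul]
  linear_combination (-(1 / 2) * fderiv ℂ f y (dx i)) * Complex.I_sq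

theorem wirtBar_of_holomorphic (i : Fin n) (hf : DifferentiableAt ℂ f y) :
    wirtBar i f y = 0 := by
  simp only [wirtBar, hf.fderiv_restrictScalars ℝ, ContinuousLinearMap.coe_restrictScalars',
    map_smul, smul_eq_mul]
  linear_combination ((1 / 2) * fderiv ℂ f y (dx i)) * Complex.I_sq

/-- The chain rule has no ∂f/∂w̄ᵃ term: the differential of F is complex linear, so the antilinear
part of the differential of f cancels in the combination defining ∂/∂zⁱ. -/
theorem wirt_comp_holomorphic (i : Fin n) {F : Cn n → Cn n} (hF : DifferentiableAt ℂ F y)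
    (hf : DifferentiableAt ℝ f (F y)) :
    wirt i (fun x => f (F x)) y = ∑ a, fderiv ℂ F y (dx i) a * wirt a f (F y) := by
  have h : HasFDerivAt (fun x => f (F x))
      ((fderiv ℝ f (F y)).comp ((fderiv ℂ F y).restrictScalars ℝ)) y :=
    hf.hasFDerivAt.comp y (hF.hasFDerivAt.restrictScalars ℝ)
  rw [wirt, h.fderiv]
  simp only [ContinuousLinearMap.comp_apply, ContinuousLinearMap.coe_restrictScalars', map_smul]
  rw [real_linear_apply _ (fderiv ℂ F y (dx i)),
    real_linear_apply _ (Complex.I • fderiv ℂ F y (dx i)), Finset.mul_sum,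
    ← Finset.sum_sub_distrib, Finset.mul_sum]
  refine Finset.sum_congr rfl fun a _ => ?_
  simp only [Pi.smul_apply, smul_eq_mul, map_mul, Complex.conj_I, wirt]
  generalize fderiv ℝ f (F y) (dx a) = A
  generalize fderiv ℝ f (F y) (Complex.I • dx a) = B
  generalize fderiv ℂ F y (dx i) a = w
  linear_combination (-(1 / 4) * ((A - Complex.I * B) * w - (A + Complex.I * B) * conj w)) *
    Complex.I_sq

end Wirtinger

/-! ### Coordinate changes, their Jacobians and the differentials of charts. -/

section Transition

set_option linter.unusedSectionVars false

variable {n : ℕ} {M : Type*} [TopologicalSpace M] [ChartedSpace (Cn n) M]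
  {e e' : OpenPartialHomeomorph M (Cn n)} {y : Cn n}

/-- The coordinate change from `e` to `e'`. -/
def trans (e e' : OpenPartialHomeomorph M (Cn n)) (y : Cn n) : Cn n := e' (e.symm y)

/-- The Jacobian matrix `∂wᵃ/∂zⁱ` of the coordinate change from `z = e` to `w = e'`. -/
def jac (e e' : OpenPartialHomeomorph M (Cn n)) (y : Cn n) : Matrix (Fin n) (Fin n) ℂ :=
  Matrix.of fun a i => fderiv ℂ (trans e e') y (dx i) a

/-- The part of the range of `e` on which the coordinate change to `e'` is defined. -/
def overlap (e e' : OpenPartialHomeomorph M (Cn n)) : Set (Cn n) :=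
  e.target ∩ e.symm ⁻¹' e'.source

theorem isOpen_overlap : IsOpen (overlap e e') := e.symm.isOpen_inter_preimage e'.open_source

theorem overlap_mem_nhds (hy : y ∈ overlap e e') : overlap e e' ∈ nhds y :=
  isOpen_overlap.mem_nhds hy

theorem trans_mem_overlap (hy : y ∈ overlap e e') : trans e e' y ∈ overlap e' e := by
  refine ⟨e'.map_source hy.2, ?_⟩
  simp only [Set.mem_preimage, trans, e'.left_inv hy.2]
  exact e.map_target hy.1

theorem symm_trans (hy : y ∈ overlap e e') : e'.symm (trans e e' y) = e.symm y :=
  e'.left_inv hy.2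

theorem trans_trans (hy : y ∈ overlap e e') : trans e' e (trans e e' y) = y := by
  rw [trans, symm_trans hy, e.right_inv hy.1]

variable [IsManifold 𝓘(ℂ, Cn n) ω M]

theorem chartAt_mem_coords (p : M) : chartAt (Cn n) p ∈ coords n M :=
  IsManifold.chart_mem_maximalAtlas p

theorem contDiffOn_trans (he : e ∈ coords n M) (he' : e' ∈ coords n M) :
    ContDiffOn ℂ ω (trans e e') (overlap e e') := by
  have h := StructureGroupoid.compatible_of_mem_maximalAtlas he he'
  rw [contDiffGroupoid, mem_groupoid_of_pregroupoid] at h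
  have h1 := h.1
  simp only [contDiffPregroupoid] at h1
  simpa [Function.comp_def, overlap, funext_iff, trans] using! h1

theorem differentiableAt_trans (he : e ∈ coords n M) (he' : e' ∈ coords n M)
    (hy : y ∈ overlap e e') : DifferentiableAt ℂ (trans e e') y :=
  ((contDiffOn_trans he he').differentiableOn (by simp)).differentiableAt (overlap_mem_nhds hy)

theorem fderiv_trans_eq (hy : y ∈ overlap e e') (w : Cn n) (he : e ∈ coords n M)
    (he' : e' ∈ coords n M) :
    fderiv ℂ (trans e' e) (trans e e' y) (fderiv ℂ (trans e e') y w) = w := by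
  have h1 := (differentiableAt_trans he' he (trans_mem_overlap hy)).hasFDerivAt.comp y
    (differentiableAt_trans he he' hy).hasFDerivAt
  have h2 : trans e' e ∘ trans e e' =ᶠ[nhds y] id :=
    Filter.eventually_of_mem (overlap_mem_nhds hy) fun x hx => trans_trans hx
  have h3 := h1.unique ((hasFDerivAt_id y).congr_of_eventuallyEq h2)
  exact DFunLike.congr_fun h3 w

/-- The differential of the inverse of a chart, as an endomorphism of `ℂⁿ`. -/
def cframe (e : OpenPartialHomeomorph M (Cn n)) (y : Cn n) : Cn n →L[ℂ] Cn n := frame e y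

/-- The tangent space at p is a copy of ℂⁿ, read through the preferred chart at p. The differential
of an inverse chart is therefore the differential of a coordinate change. -/
theorem cframe_eq (he : e ∈ coords n M) (hy : y ∈ e.target) :
    cframe e y = fderiv ℂ (trans e (chartAt (Cn n) (e.symm y))) y := by
  have h1 : MDifferentiableAt 𝓘(ℂ, Cn n) 𝓘(ℂ, Cn n) e.symm y :=
    ((contMDiffOn_symm_of_mem_maximalAtlas he).contMDiffAt
      (e.open_target.mem_nhds hy)).mdifferentiableAt (by simp)
  have h2 : cframe e y = _ := h1.mfderiv
  rw [h2]
  simp [writtenInExtChartAt, Function.comp_def, fderivWithin_univ, extChartAt]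
  rfl

theorem cframe_trans (he : e ∈ coords n M) (he' : e' ∈ coords n M) (hy : y ∈ overlap e e') :
    cframe e y = (cframe e' (trans e e' y)).comp (fderiv ℂ (trans e e') y) := by
  rw [cframe_eq he hy.1, cframe_eq he' (trans_mem_overlap hy).1, symm_trans hy]
  set c := chartAt (Cn n) (e.symm y)
  have hc : c ∈ coords n M := chartAt_mem_coords _
  have hs : e.symm y ∈ c.source := mem_chart_source _ _
  have hy2 : trans e e' y ∈ overlap e' c :=
    ⟨(trans_mem_overlap hy).1, by simpa [symm_trans hy] using hs⟩
  have h1 := (differentiableAt_trans he' hc hy2).hasFDerivAt.comp y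
    (differentiableAt_trans he he' hy).hasFDerivAt
  rw [← h1.fderiv]
  refine Filter.EventuallyEq.fderiv_eq ?_
  filter_upwards [overlap_mem_nhds hy] with x hx
  simp [trans, e'.left_inv hx.2]

theorem fderiv_trans_apply (w : Cn n) (a : Fin n) :
    fderiv ℂ (trans e e') y w a = ∑ i, jac e e' y a i * w i := by
  conv_lhs => rw [eq_sum_smul_dx w, map_sum]
  simp [jac, Finset.sum_apply, mul_comm]

theorem jac_mul_jac (he : e ∈ coords n M) (he' : e' ∈ coords n M) (hy : y ∈ overlap e e') :
    jac e' e (trans e e' y) * jac e e' y = 1 := by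
  ext a i
  have h := fderiv_trans_eq hy (dx i) he he'
  rw [Matrix.mul_apply, Matrix.one_apply]
  have h2 := congrFun h a
  rw [fderiv_trans_apply] at h2
  simpa [jac, dx, Pi.single_apply] using h2

theorem isUnit_det_jac (he : e ∈ coords n M) (he' : e' ∈ coords n M) (hy : y ∈ overlap e e') :
    IsUnit (jac e e' y).det :=
  Matrix.isUnit_det_of_left_inverse (jac_mul_jac he he' hy)

variable {𝕂 : Type*} [NormedAddCommGroup 𝕂] [NormedSpace ℝ 𝕂] {k : ℕ}

theorem Form.rep_trans (α : Form n M 𝕂 k) (he : e ∈ coords n M) (he' : e' ∈ coords n M)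
    (hy : y ∈ overlap e e') (v : Fin k → Cn n) :
    α.rep e y v = α.rep e' (trans e e' y) fun i => fderiv ℂ (trans e e') y (v i) := by
  -- All tangent spaces are definitionally ℂⁿ. Viewing α as a non-dependent function makes it
  -- possible to rewrite the base point.
  let A : M → (Cn n [⋀^Fin k]→L[ℝ] 𝕂) := α
  change A (e.symm y) (fun i => cframe e y (v i)) =
    A (e'.symm (trans e e' y)) (fun i => cframe e' (trans e e' y)
      (fderiv ℂ (trans e e') y (v i)))
  rw [symm_trans hy, cframe_trans he he' hy]
  rfl

/-- This links the invariant value of a form at p with its expression in the preferred chart. It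
holds at the point p itself, not at other points of that chart. -/
theorem cframe_chartAt (p : M) : cframe (chartAt (Cn n) p) (chartAt (Cn n) p p) =
    ContinuousLinearMap.id ℂ (Cn n) := by
  rw [cframe_eq (chartAt_mem_coords p) (mem_chart_target _ p),
    (chartAt (Cn n) p).left_inv (mem_chart_source _ p)]
  refine ((hasFDerivAt_id _).congr_of_eventuallyEq ?_).fderiv
  filter_upwards [(chartAt (Cn n) p).open_target.mem_nhds (mem_chart_target _ p)] with x hx
  exact (chartAt (Cn n) p).right_inv hx

theorem mem_overlap_chartAt (hy : y ∈ e.target) : y ∈ overlap e (chartAt (Cn n) (e.symm y)) :=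
  ⟨hy, mem_chart_source _ _⟩

theorem cframe_injective (he : e ∈ coords n M) (hy : y ∈ e.target) :
    Function.Injective (cframe e y) := by
  rw [cframe_eq he hy]
  exact Function.LeftInverse.injective fun w =>
    fderiv_trans_eq (mem_overlap_chartAt hy) w he (chartAt_mem_coords _)

end Transition

/-! ### The Hermitian matrix of the metric in a chart. -/

section Hermitian

open scoped ComplexOrder

set_option linter.unusedSectionVars false

variable {n : ℕ} {M : Type*} [TopologicalSpace M] [ChartedSpace (Cn n) M]
  {e e' : OpenPartialHomeomorph M (Cn n)} {y : Cn n}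

namespace HermitianMetric

variable (G : HermitianMetric n M)

/-- The expression of the Riemannian metric in a chart. -/
def gRep (e : OpenPartialHomeomorph M (Cn n)) (y : Cn n) (u v : Cn n) : ℝ :=
  G.g (e.symm y) (frame e y u) (frame e y v)

theorem gRep_add_left (u u' v : Cn n) :
    G.gRep e y (u + u') v = G.gRep e y u v + G.gRep e y u' v := by
  simp [gRep]

theorem gRep_smul_left (c : ℝ) (u v : Cn n) :
    G.gRep e y (c • u) v = c * G.gRep e y u v := by
  have h : (cframe e y) (c • u) = c • cframe e y u := by
    simp
  change G.g (e.symm y) (cframe e y (c • u)) _ = _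
  rw [h]
  exact congrArg (fun L => L (frame e y v)) (map_smul (G.g (e.symm y)) c (frame e y u))

theorem gRep_symm (u v : Cn n) : G.gRep e y u v = G.gRep e y v u := G.symm _ _ _

theorem gRep_map_J (u v : Cn n) :
    G.gRep e y (Complex.I • u) (Complex.I • v) = G.gRep e y u v := by
  simp only [gRep, map_smul]
  exact G.map_J _ _ _

theorem gRep_J_left (u v : Cn n) :
    G.gRep e y (Complex.I • u) v = -G.gRep e y u (Complex.I • v) := by
  have h := G.gRep_map_J (e := e) (y := y) u (Complex.I • v)
  rw [smul_smul, Complex.I_mul_I] at h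
  have h2 := G.gRep_smul_left (e := e) (y := y) (-1) v (Complex.I • u)
  rw [G.gRep_symm, neg_one_smul] at h2
  rw [neg_one_smul, h2] at h
  rw [← h, G.gRep_symm v]
  ring

theorem gRep_J_J_right (u v : Cn n) :
    G.gRep e y u (Complex.I • Complex.I • v) = -G.gRep e y u v := by
  rw [← G.gRep_map_J u v, gRep_J_left, neg_neg]

theorem gRep_J_self (u : Cn n) : G.gRep e y u (Complex.I • u) = 0 := by
  have h := G.gRep_J_left (e := e) (y := y) u u
  rw [G.gRep_symm] at h
  linarith

theorem gRep_pos [IsManifold 𝓘(ℂ, Cn n) ω M] (he : e ∈ coords n M) (hy : y ∈ e.target) {u : Cn n}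
    (hu : u ≠ 0) : 0 < G.gRep e y u u := by
  refine G.pos _ _ fun h => hu (cframe_injective he hy ?_)
  rw [map_zero]
  exact h

theorem gRep_trans [IsManifold 𝓘(ℂ, Cn n) ω M] (he : e ∈ coords n M) (he' : e' ∈ coords n M)
    (hy : y ∈ overlap e e') (u v : Cn n) :
    G.gRep e y u v = G.gRep e' (trans e e' y) (fderiv ℂ (trans e e') y u)
      (fderiv ℂ (trans e e') y v) := by
  let A : M → (Cn n →L[ℝ] Cn n →L[ℝ] ℝ) := G.g
  change A (e.symm y) (cframe e y u) (cframe e y v) =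
    A (e'.symm (trans e e' y)) (cframe e' (trans e e' y) _) (cframe e' (trans e e' y) _)
  rw [symm_trans hy, cframe_trans he he' hy]
  rfl

/-- The Hermitian form `h(u, v̄)`, complex linear in `u` and antilinear in `v`. -/
def hForm (e : OpenPartialHomeomorph M (Cn n)) (y : Cn n) (u v : Cn n) : ℂ :=
  (1 / 2) * (G.gRep e y u v + Complex.I * G.gRep e y u (Complex.I • v))

/-- J-invariance makes the four terms of `mixedComp` coincide in pairs, leaving ½(g(u, v) + √-1 g(u,
Jv)). -/
theorem h_apply (i j : Fin n) : G.h e y i j = G.hForm e y (dx i) (dx j) := by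
  change mixedComp (fun u v => (G.gRep e y u v : ℂ)) i j = _
  simp only [mixedComp, hForm, gRep_J_J_right, gRep_J_left]
  push_cast
  ring

theorem hForm_conj (u v : Cn n) : conj (G.hForm e y u v) = G.hForm e y v u := by
  simp only [hForm, map_mul, map_add, map_div₀, map_one, map_ofNat, Complex.conj_I,
    Complex.conj_ofReal, G.gRep_symm v, gRep_J_left]
  push_cast
  ring

theorem hForm_add_left (u u' v : Cn n) :
    G.hForm e y (u + u') v = G.hForm e y u v + G.hForm e y u' v := by
  simp only [hForm, gRep_add_left]
  push_cast
  ring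

theorem hForm_smul_left (c : ℂ) (u v : Cn n) : G.hForm e y (c • u) v = c * G.hForm e y u v := by
  have h : c • u = c.re • u + c.im • (Complex.I • u) := by
    have h2 : c • u = (c.re + c.im * Complex.I) • u := by rw [Complex.re_add_im]
    rw [h2, add_smul, mul_smul]
    rfl
  rw [h, hForm]
  simp only [gRep_add_left, gRep_smul_left, gRep_J_J_right, gRep_J_left]
  conv_rhs => rw [← Complex.re_add_im c, hForm]
  push_cast
  linear_combination (-(1 / 2) * c.im * G.gRep e y u (Complex.I • v)) * Complex.I_sq

/-- `h(·, v̄)` as a linear form. -/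
def hFormLin (e : OpenPartialHomeomorph M (Cn n)) (y v : Cn n) : Cn n →ₗ[ℂ] ℂ where
  toFun u := G.hForm e y u v
  map_add' u u' := G.hForm_add_left u u' v
  map_smul' c u := G.hForm_smul_left c u v

theorem hForm_eq_sum_left (u v : Cn n) : G.hForm e y u v = ∑ i, u i * G.hForm e y (dx i) v := by
  change G.hFormLin e y v u = ∑ i, u i * G.hFormLin e y v (dx i)
  conv_lhs => rw [eq_sum_smul_dx u, map_sum]
  simp

theorem hForm_eq_sum (u v : Cn n) :
    G.hForm e y u v = ∑ i, ∑ j, u i * G.h e y i j * conj (v j) := by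
  rw [hForm_eq_sum_left]
  refine Finset.sum_congr rfl fun i _ => ?_
  rw [← G.hForm_conj v, hForm_eq_sum_left, map_sum, Finset.mul_sum]
  refine Finset.sum_congr rfl fun j _ => ?_
  rw [map_mul, G.hForm_conj, h_apply]
  ring

theorem h_conj (i j : Fin n) : conj (G.h e y i j) = G.h e y j i := by
  rw [h_apply, h_apply, hForm_conj]

theorem hForm_self (u : Cn n) : G.hForm e y u u = ((1 / 2 * G.gRep e y u u : ℝ) : ℂ) := by
  rw [hForm, gRep_J_self]
  push_cast
  ring

variable [IsManifold 𝓘(ℂ, Cn n) ω M]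

theorem h_posDef (he : e ∈ coords n M) (hy : y ∈ e.target) : (G.h e y).PosDef := by
  refine Matrix.PosDef.of_dotProduct_mulVec_pos ?_ fun x hx => ?_
  · ext i j
    rw [Matrix.conjTranspose_apply]
    exact G.h_conj j i
  -- `hForm` is linear in its first argument and antilinear in its second, so the vector to insert
  -- is the conjugate of x.
  · have h1 : star x ⬝ᵥ (G.h e y).mulVec x = G.hForm e y (star x) (star x) := by
      rw [hForm_eq_sum]
      simp [dotProduct, Matrix.mulVec, Finset.mul_sum, mul_assoc]
    rw [h1, hForm_self]
    have h2 := G.gRep_pos he hy (star_ne_zero.2 hx)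
    exact_mod_cast by positivity

theorem h_trans (he : e ∈ coords n M) (he' : e' ∈ coords n M) (hy : y ∈ overlap e e') :
    G.h e y = (jac e e' y).transpose * G.h e' (trans e e' y) * (jac e e' y).map conj := by
  ext i j
  have h1 : ∀ u v, G.hForm e y u v = G.hForm e' (trans e e' y) (fderiv ℂ (trans e e') y u)
      (fderiv ℂ (trans e e') y v) := by
    intro u v
    simp only [hForm, G.gRep_trans he he' hy, map_smul]
  rw [h_apply, h1, hForm_eq_sum]
  simp only [Matrix.mul_apply, Matrix.transpose_apply, Matrix.map_apply, Finset.sum_mul]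
  rw [Finset.sum_comm]
  rfl

theorem det_h_pos (he : e ∈ coords n M) (hy : y ∈ e.target) : 0 < (G.h e y).det :=
  (G.h_posDef he hy).det_pos

theorem isUnit_det_h (he : e ∈ coords n M) (hy : y ∈ e.target) : IsUnit (G.h e y).det :=
  (G.det_h_pos he hy).ne'.isUnit

theorem hInv_conj (he : e ∈ coords n M) (hy : y ∈ e.target) (i j : Fin n) :
    conj (G.hInv e y i j) = G.hInv e y j i :=
  (G.h_posDef he hy).inv.isHermitian.apply i j

theorem sum_hInv_mul_h (he : e ∈ coords n M) (hy : y ∈ e.target) (k i : Fin n) :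
    ∑ l, G.hInv e y k l * G.h e y i l = if k = i then 1 else 0 := by
  have h := congrFun (congrFun (Matrix.mul_nonsing_inv _ (G.isUnit_det_h he hy)) i) k
  rw [Matrix.mul_apply, Matrix.one_apply] at h
  simp only [hInv, mul_comm ((G.h e y)⁻¹ _ _), h, eq_comm]

theorem sum_h_mul_hInv (he : e ∈ coords n M) (hy : y ∈ e.target) (l j : Fin n) :
    ∑ k, G.hInv e y k l * G.h e y k j = if l = j then 1 else 0 := by
  have h := congrFun (congrFun (Matrix.nonsing_inv_mul _ (G.isUnit_det_h he hy)) l) j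
  rw [Matrix.mul_apply, Matrix.one_apply] at h
  simp only [hInv, h]

theorem contDiffOn_h (he : e ∈ coords n M) (i j : Fin n) :
    ContDiffOn ℝ ∞ (fun y => G.h e y i j) e.target := by
  have h1 : ∀ u v : Cn n, ContDiffOn ℝ ∞ (fun y => (G.gRep e y u v : ℂ)) e.target := fun u v =>
    Complex.ofRealCLM.contDiff.comp_contDiffOn (G.smooth e he u v)
  simp only [h_apply, hForm]
  exact contDiffOn_const.mul ((h1 _ _).add (contDiffOn_const.mul (h1 _ _)))

end HermitianMetric

end Hermitian

/-! ### Derivatives of determinants and smoothness of inverse matrices. -/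

section Det

variable {n : ℕ} {y : Cn n} {U : Set (Cn n)}

theorem wirt_prod {ι : Type*} [DecidableEq ι] (s : Finset ι) (i : Fin n) {f : ι → Cn n → ℂ}
    (hf : ∀ a ∈ s, DifferentiableAt ℝ (f a) y) :
    wirt i (fun x => ∏ a ∈ s, f a x) y = ∑ a ∈ s, wirt i (f a) y * ∏ b ∈ s.erase a, f b y := by
  have h := (HasFDerivAt.finsetProd (u := s) fun a ha => (hf a ha).hasFDerivAt).fderiv
  simp only [wirt, h, _root_.sum_apply, _root_.smul_apply, smul_eq_mul, Finset.mul_sum,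
    ← Finset.sum_sub_distrib]
  exact Finset.sum_congr rfl fun a _ => by ring

theorem differentiableAt_prod {ι : Type*} [DecidableEq ι] (s : Finset ι) {f : ι → Cn n → ℂ}
    (hf : ∀ a ∈ s, DifferentiableAt ℝ (f a) y) :
    DifferentiableAt ℝ (fun x => ∏ a ∈ s, f a x) y :=
  (HasFDerivAt.finsetProd (u := s) fun a ha => (hf a ha).hasFDerivAt).differentiableAt

/-- Jacobi's formula. The product rule in the Leibniz expansion differentiates one column at a time,
and Cramer's rule identifies the resulting determinant with a row of the adjugate applied to the
differentiated column. -/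
theorem wirt_det {m : ℕ} (i : Fin n) {A : Cn n → Matrix (Fin m) (Fin m) ℂ}
    (hA : ∀ k l, DifferentiableAt ℝ (fun x => A x k l) y) :
    wirt i (fun x => (A x).det) y =
      ∑ l, ∑ k, (A y).adjugate l k * wirt i (fun x => A x k l) y := by
  have h1 : ∀ l, ∑ k, (A y).adjugate l k * wirt i (fun x => A x k l) y =
      ((A y).updateCol l fun k => wirt i (fun x => A x k l) y).det := by
    intro l
    rw [← Matrix.cramer_apply, Matrix.cramer_eq_adjugate_mulVec]
    rfl
  simp only [h1, Matrix.det_apply']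
  rw [Finset.sum_comm, wirt_sum]
  · refine Finset.sum_congr rfl fun σ _ => ?_
    rw [wirt_const_mul, wirt_prod, Finset.mul_sum]
    · refine Finset.sum_congr rfl fun a ha => ?_
      rw [← Finset.mul_prod_erase _ _ ha, Matrix.updateCol_self]
      congr 2
      refine Finset.prod_congr rfl fun b hb => ?_
      rw [Matrix.updateCol_ne (Finset.ne_of_mem_erase hb)]
    · exact fun a _ => hA _ _
    · exact differentiableAt_prod _ fun a _ => hA (σ a) a
  · exact fun σ _ => (differentiableAt_const _).fun_mul
      (differentiableAt_prod _ fun a _ => hA (σ a) a)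

theorem contDiffOn_det {m : ℕ} {A : Cn n → Matrix (Fin m) (Fin m) ℂ}
    (hA : ∀ k l, ContDiffOn ℝ ∞ (fun x => A x k l) U) :
    ContDiffOn ℝ ∞ (fun x => (A x).det) U := by
  simp only [Matrix.det_apply']
  exact ContDiffOn.sum fun σ _ => contDiffOn_const.mul (contDiffOn_prod fun a _ => hA _ _)

theorem contDiffOn_inv {m : ℕ} {A : Cn n → Matrix (Fin m) (Fin m) ℂ}
    (hA : ∀ k l, ContDiffOn ℝ ∞ (fun x => A x k l) U) (h0 : ∀ x ∈ U, IsUnit (A x).det)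
    (k l : Fin m) : ContDiffOn ℝ ∞ (fun x => (A x)⁻¹ k l) U := by
  have h1 : ContDiffOn ℝ ∞ (fun x => ((A x).det)⁻¹ * (A x).adjugate k l) U := by
    refine ((contDiffOn_det hA).inv fun x hx => (h0 x hx).ne_zero).mul ?_
    simp only [Matrix.adjugate_apply]
    refine contDiffOn_det fun a b => ?_
    by_cases hab : a = l
    · subst hab
      simpa using contDiffOn_const
    · simpa [Matrix.updateRow_ne hab] using hA a b
  refine h1.congr fun x hx => ?_
  simp [Matrix.inv_def, Matrix.smul_apply]

end Det

/-! ### Traces, Chern curvature and the torsion trace in a chart. -/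

namespace HermitianMetric

section Local

set_option linter.unusedSectionVars false

variable {n : ℕ} {M : Type*} [TopologicalSpace M] [ChartedSpace (Cn n) M]
  [IsManifold 𝓘(ℂ, Cn n) ω M] {e e' : OpenPartialHomeomorph M (Cn n)} {y : Cn n}
  (G : HermitianMetric n M)

theorem contDiffOn_hInv (he : e ∈ coords n M) (i j : Fin n) :
    ContDiffOn ℝ ∞ (fun y => G.hInv e y i j) e.target :=
  contDiffOn_inv (G.contDiffOn_h he) (fun _ hx => G.isUnit_det_h he hx) j i

theorem contDiffOn_Γ (he : e ∈ coords n M) (i j k : Fin n) :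
    ContDiffOn ℝ ∞ (fun y => G.Γ e y i j k) e.target :=
  ContDiffOn.sum fun _ _ => (G.contDiffOn_hInv he _ _).mul
    (contDiffOn_wirt e.open_target (G.contDiffOn_h he _ _) _)

theorem differentiableAt_h (he : e ∈ coords n M) (hy : y ∈ e.target) (i j : Fin n) :
    DifferentiableAt ℝ (fun y => G.h e y i j) y :=
  (G.contDiffOn_h he i j).differentiableAt_of_isOpen e.open_target hy

theorem differentiableAt_hInv (he : e ∈ coords n M) (hy : y ∈ e.target) (i j : Fin n) :
    DifferentiableAt ℝ (fun y => G.hInv e y i j) y :=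
  (G.contDiffOn_hInv he i j).differentiableAt_of_isOpen e.open_target hy

theorem differentiableAt_Γ (he : e ∈ coords n M) (hy : y ∈ e.target) (i j k : Fin n) :
    DifferentiableAt ℝ (fun y => G.Γ e y i j k) y :=
  (G.contDiffOn_Γ he i j k).differentiableAt_of_isOpen e.open_target hy

/-- `h^{kl̄} X_{kl̄}`. -/
def tr (e : OpenPartialHomeomorph M (Cn n)) (y : Cn n) (X : Fin n → Fin n → ℂ) : ℂ :=
  ∑ k, ∑ l, G.hInv e y k l * X k l

theorem tr_eq_trace (X : Matrix (Fin n) (Fin n) ℂ) :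
    G.tr e y X = ((G.h e y)⁻¹ * X).trace := by
  simp only [tr, hInv, Matrix.trace, Matrix.diag, Matrix.mul_apply]
  rw [Finset.sum_comm]

theorem tr_add (X Y : Fin n → Fin n → ℂ) :
    G.tr e y (fun k l => X k l + Y k l) = G.tr e y X + G.tr e y Y := by
  simp only [tr, mul_add, Finset.sum_add_distrib]

theorem tr_sub (X Y : Fin n → Fin n → ℂ) :
    G.tr e y (fun k l => X k l - Y k l) = G.tr e y X - G.tr e y Y := by
  simp only [tr, mul_sub, Finset.sum_sub_distrib]

theorem tr_mul_left (c : ℂ) (X : Fin n → Fin n → ℂ) :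
    G.tr e y (fun k l => c * X k l) = c * G.tr e y X := by
  simp only [tr, Finset.mul_sum]
  exact Finset.sum_congr rfl fun k _ => Finset.sum_congr rfl fun l _ => by ring

theorem tr_conj (he : e ∈ coords n M) (hy : y ∈ e.target) (X : Fin n → Fin n → ℂ) :
    conj (G.tr e y X) = G.tr e y (fun k l => conj (X l k)) := by
  simp only [tr, map_sum, map_mul, G.hInv_conj he hy]
  rw [Finset.sum_comm]

theorem tr_h_row (he : e ∈ coords n M) (hy : y ∈ e.target) (c : Fin n → ℂ) (j : Fin n) :
    G.tr e y (fun k l => c k * G.h e y j l) = c j := by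
  have h : ∀ k, ∑ l, G.hInv e y k l * (c k * G.h e y j l) =
      c k * ∑ l, G.hInv e y k l * G.h e y j l := fun k => by
    rw [Finset.mul_sum]
    exact Finset.sum_congr rfl fun l _ => by ring
  simp [tr, h, G.sum_hInv_mul_h he hy]

theorem tr_h_col (he : e ∈ coords n M) (hy : y ∈ e.target) (c : Fin n → ℂ) (j : Fin n) :
    G.tr e y (fun k l => c l * G.h e y k j) = c j := by
  have h : ∀ l, ∑ k, G.hInv e y k l * (c l * G.h e y k j) =
      c l * ∑ k, G.hInv e y k l * G.h e y k j := fun k => by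
    rw [Finset.mul_sum]
    exact Finset.sum_congr rfl fun l _ => by ring
  rw [tr, Finset.sum_comm]
  simp [h, G.sum_h_mul_hInv he hy]

theorem tr_h (he : e ∈ coords n M) (hy : y ∈ e.target) : G.tr e y (G.h e y) = n := by
  rw [tr_eq_trace, Matrix.nonsing_inv_mul _ (G.isUnit_det_h he hy)]
  simp

/-- The trace of a sesquilinear form is independent of the coordinates. -/
theorem tr_trans (he : e ∈ coords n M) (he' : e' ∈ coords n M) (hy : y ∈ overlap e e')
    (X : Matrix (Fin n) (Fin n) ℂ) :
    G.tr e y ((jac e e' y).transpose * X * (jac e e' y).map conj) =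
      G.tr e' (trans e e' y) X := by
  have h1 : IsUnit (jac e e' y).det := isUnit_det_jac he he' hy
  have h2 : IsUnit ((jac e e' y).map conj).det := by
    have h3 : ((jac e e' y).map conj).det = conj (jac e e' y).det :=
      (RingHom.map_det (starRingEnd ℂ) _).symm
    rw [h3]
    exact h1.map (starRingEnd ℂ)
  have h4 : IsUnit ((jac e e' y).transpose).det := by rwa [Matrix.det_transpose]
  rw [tr_eq_trace, tr_eq_trace, G.h_trans he he' hy, Matrix.mul_inv_rev, Matrix.mul_inv_rev]
  rw [show ∀ A B C D E : Matrix (Fin n) (Fin n) ℂ, A * (B * C) * (D * X * E) =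
    A * ((B * (C * D)) * X * E) from fun A B C D E => by simp only [Matrix.mul_assoc]]
  rw [Matrix.nonsing_inv_mul _ h4, Matrix.mul_one, Matrix.trace_mul_comm, Matrix.mul_assoc,
    Matrix.mul_nonsing_inv _ h2, Matrix.mul_one]

theorem sum_h_mul_Γ (he : e ∈ coords n M) (hy : y ∈ e.target) (i k l : Fin n) :
    ∑ p, G.h e y p l * G.Γ e y i k p = wirt i (fun x => G.h e x k l) y := by
  have h := G.tr_h_col he hy (fun q => wirt i (fun x => G.h e x k q) y) l
  rw [← h, tr]
  refine Finset.sum_congr rfl fun p _ => ?_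
  rw [Γ, Finset.mul_sum]
  exact Finset.sum_congr rfl fun q _ => by ring

/-- Apply ∂_j̄ to h_{pl̄} Γ_{ik}^p = ∂_i h_{kl̄}. The resulting formula -∂_j̄ ∂_i h + h⁻¹ · ∂̄h · ∂h
shows how the curvature behaves under conjugation. -/
theorem R_eq (he : e ∈ coords n M) (hy : y ∈ e.target) (i j k l : Fin n) :
    G.R e y i j k l = -wirtBar j (wirt i fun x => G.h e x k l) y +
      G.tr e y (fun p q => wirtBar j (fun x => G.h e x p l) y *
        wirt i (fun x => G.h e x k q) y) := by
  have h1 : wirtBar j (wirt i fun x => G.h e x k l) y =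
      wirtBar j (fun x => ∑ p, G.h e x p l * G.Γ e x i k p) y := by
    refine wirtBar_congr j ?_
    filter_upwards [e.open_target.mem_nhds hy] with x hx
    exact (G.sum_h_mul_Γ he hx i k l).symm
  rw [h1, wirtBar_sum _ _ fun p _ =>
    (G.differentiableAt_h he hy p l).fun_mul (G.differentiableAt_Γ he hy i k p)]
  have h2 : ∀ p, wirtBar j (fun x => G.h e x p l * G.Γ e x i k p) y =
      G.h e y p l * wirtBar j (fun x => G.Γ e x i k p) y +
        wirtBar j (fun x => G.h e x p l) y * G.Γ e y i k p := fun p =>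
    wirtBar_mul j (G.differentiableAt_h he hy p l) (G.differentiableAt_Γ he hy i k p)
  have h3 : ∑ p, wirtBar j (fun x => G.h e x p l) y * G.Γ e y i k p =
      G.tr e y (fun p q => wirtBar j (fun x => G.h e x p l) y *
        wirt i (fun x => G.h e x k q) y) := by
    simp only [tr, Γ, Finset.mul_sum]
    exact Finset.sum_congr rfl fun p _ => Finset.sum_congr rfl fun q _ => by ring
  simp only [h2, Finset.sum_add_distrib, R]
  linear_combination h3

theorem wirt_h_conj (he : e ∈ coords n M) (hy : y ∈ e.target) (i k l : Fin n) :
    conj (wirt i (fun x => G.h e x k l) y) = wirtBar i (fun x => G.h e x l k) y := by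
  rw [← wirtBar_conj i (G.differentiableAt_h he hy k l)]
  simp only [h_conj]

theorem wirtBar_h_conj (he : e ∈ coords n M) (hy : y ∈ e.target) (i k l : Fin n) :
    conj (wirtBar i (fun x => G.h e x k l) y) = wirt i (fun x => G.h e x l k) y := by
  rw [← G.wirt_h_conj he hy, Complex.conj_conj]

theorem R_conj (he : e ∈ coords n M) (hy : y ∈ e.target) (i j k l : Fin n) :
    conj (G.R e y i j k l) = G.R e y j i l k := by
  rw [G.R_eq he hy, G.R_eq he hy, map_add, map_neg, G.tr_conj he hy]
  have h1 : conj (wirtBar j (wirt i fun x => G.h e x k l) y) =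
      wirtBar i (wirt j fun x => G.h e x l k) y := by
    rw [wirtBar_wirt_comm e.open_target (G.contDiffOn_h he l k) hy, ← wirt_conj]
    · refine wirt_congr j ?_
      filter_upwards [e.open_target.mem_nhds hy] with x hx
      exact G.wirt_h_conj he hx i k l
    · exact (contDiffOn_wirt e.open_target (G.contDiffOn_h he k l) i).differentiableAt_of_isOpen
        e.open_target hy
  rw [h1]
  simp only [map_mul, G.wirt_h_conj he hy, G.wirtBar_h_conj he hy, mul_comm]

theorem wirtBar_Γ (he : e ∈ coords n M) (hy : y ∈ e.target) (i j k p : Fin n) :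
    wirtBar j (fun x => G.Γ e x i k p) y = -∑ l, G.hInv e y p l * G.R e y i j k l := by
  simp only [R, mul_neg, Finset.sum_neg_distrib, neg_neg, Finset.mul_sum]
  rw [Finset.sum_comm]
  have h : ∀ q, ∑ l, G.hInv e y p l * (G.h e y q l * wirtBar j (fun x => G.Γ e x i k q) y) =
      (∑ l, G.hInv e y p l * G.h e y q l) * wirtBar j (fun x => G.Γ e x i k q) y := fun q => by
    rw [Finset.sum_mul]
    exact Finset.sum_congr rfl fun l _ => by ring
  simp [h, G.sum_hInv_mul_h he hy]

/-- The trace `τ_k = T_{ka}^a` of the torsion of the Chern connection. -/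
def torsionTrace (e : OpenPartialHomeomorph M (Cn n)) (y : Cn n) (k : Fin n) : ℂ :=
  ∑ a, (G.Γ e y k a a - G.Γ e y a k a)

theorem contDiffOn_torsionTrace (he : e ∈ coords n M) (k : Fin n) :
    ContDiffOn ℝ ∞ (fun y => G.torsionTrace e y k) e.target :=
  ContDiffOn.sum fun _ _ => (G.contDiffOn_Γ he _ _ _).sub (G.contDiffOn_Γ he _ _ _)

theorem torsionTrace_eq_tr (k : Fin n) :
    G.torsionTrace e y k = G.tr e y (fun a b =>
      wirt k (fun x => G.h e x a b) y - wirt a (fun x => G.h e x k b) y) := by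
  simp only [torsionTrace, tr, Γ, mul_sub, Finset.sum_sub_distrib]

/-- Since ∂_j̄ Γ is minus the curvature with one index raised, ∂̄τ measures how far R is from
symmetric in its two unbarred indices. This links ∂*ω with the two Ricci forms. -/
theorem wirtBar_torsionTrace (he : e ∈ coords n M) (hy : y ∈ e.target) (i j : Fin n) :
    wirtBar j (fun x => G.torsionTrace e x i) y =
      G.tr e y (fun k l => G.R e y k j i l) - G.tr e y (fun k l => G.R e y i j k l) := by
  unfold torsionTrace
  rw [wirtBar_sum _ _ fun a _ => (G.differentiableAt_Γ he hy i a a).fun_sub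
    (G.differentiableAt_Γ he hy a i a)]
  simp only [wirtBar_sub j (G.differentiableAt_Γ he hy i _ _) (G.differentiableAt_Γ he hy _ i _),
    G.wirtBar_Γ he hy, Finset.sum_sub_distrib, Finset.sum_neg_distrib, tr]
  ring

/-- The derivative of an inverse matrix, from differentiating h^{kq̄} h_{pq̄} = δ_{kp} and
contracting with the inverse. -/
theorem wirt_hInv (he : e ∈ coords n M) (hy : y ∈ e.target) (i k m : Fin n) :
    wirt i (fun x => G.hInv e x k m) y =
      -∑ p, G.hInv e y p m * ∑ q, G.hInv e y k q * wirt i (fun x => G.h e x p q) y := by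
  have h1 : ∀ p, ∑ q, wirt i (fun x => G.hInv e x k q) y * G.h e y p q =
      -∑ q, G.hInv e y k q * wirt i (fun x => G.h e x p q) y := by
    intro p
    have h2 : wirt i (fun x => ∑ q, G.hInv e x k q * G.h e x p q) y = 0 := by
      rw [← wirt_const i (if k = p then 1 else 0) (y := y)]
      refine wirt_congr i ?_
      filter_upwards [e.open_target.mem_nhds hy] with x hx
      exact G.sum_hInv_mul_h he hx k p
    rw [wirt_sum _ _ fun q _ => (G.differentiableAt_hInv he hy k q).fun_mul
      (G.differentiableAt_h he hy p q)] at h2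
    simp only [wirt_mul i (G.differentiableAt_hInv he hy k _) (G.differentiableAt_h he hy p _),
      Finset.sum_add_distrib] at h2
    linear_combination h2
  have h4 : ∑ p, G.hInv e y p m * ∑ q, wirt i (fun x => G.hInv e x k q) y * G.h e y p q =
      wirt i (fun x => G.hInv e x k m) y := by
    simp only [Finset.mul_sum]
    rw [Finset.sum_comm]
    have h5 : ∀ q, ∑ p, G.hInv e y p m * (wirt i (fun x => G.hInv e x k q) y * G.h e y p q) =
        wirt i (fun x => G.hInv e x k q) y * ∑ p, G.hInv e y p m * G.h e y p q := fun q => by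
      rw [Finset.mul_sum]
      exact Finset.sum_congr rfl fun l _ => by ring
    simp [h5, G.sum_h_mul_hInv he hy]
  rw [← h4]
  simp only [h1, mul_neg, Finset.sum_neg_distrib]

theorem wirt_det_h (he : e ∈ coords n M) (hy : y ∈ e.target) (i : Fin n) :
    wirt i (fun x => (G.h e x).det) y =
      (G.h e y).det * G.tr e y (fun k l => wirt i (fun x => G.h e x k l) y) := by
  rw [wirt_det i (G.differentiableAt_h he hy), tr, Finset.sum_comm, Finset.mul_sum]
  refine Finset.sum_congr rfl fun k _ => ?_
  rw [Finset.mul_sum]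
  refine Finset.sum_congr rfl fun l _ => ?_
  rw [hInv, Matrix.inv_def, Matrix.smul_apply, smul_eq_mul, Ring.inverse_eq_inv']
  have := (G.isUnit_det_h he hy).ne_zero
  field_simp

/-- Differentiating det h contributes h^{ab̄} ∂_k h_{ab̄}, and differentiating the inverse
contributes -h^{ab̄} ∂_a h_{kb̄}. Together they form τ_k, so τ is the zeroth-order term in the
integration by parts. -/
theorem sum_wirt_hInv_mul_det (he : e ∈ coords n M) (hy : y ∈ e.target) (l : Fin n) :
    ∑ i, wirt i (fun x => G.hInv e x i l * (G.h e x).det) y =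
      (G.h e y).det * ∑ k, G.hInv e y k l * G.torsionTrace e y k := by
  have hd : DifferentiableAt ℝ (fun x => (G.h e x).det) y :=
    (contDiffOn_det (G.contDiffOn_h he)).differentiableAt_of_isOpen e.open_target hy
  simp only [wirt_mul _ (G.differentiableAt_hInv he hy _ _) hd, G.wirt_det_h he hy,
    G.wirt_hInv he hy, torsionTrace_eq_tr, tr_sub, mul_sub, Finset.sum_add_distrib,
    Finset.sum_sub_distrib]
  rw [sub_eq_add_neg, Finset.mul_sum]
  congr 1
  · exact Finset.sum_congr rfl fun i _ => by ring
  · simp only [neg_mul, Finset.sum_neg_distrib, ← Finset.sum_mul, mul_comm (G.h e y).det]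
    rw [Finset.sum_comm]
    simp only [tr, Finset.mul_sum]

end Local

/-! ### Chern-Ricci forms and scalar curvatures as iterated traces. -/

section Identities

set_option linter.unusedSectionVars false

variable {n : ℕ} {M : Type*} [TopologicalSpace M] [ChartedSpace (Cn n) M]
  [IsManifold 𝓘(ℂ, Cn n) ω M] {e e' : OpenPartialHomeomorph M (Cn n)} {y : Cn n}
  (G : HermitianMetric n M)

theorem fund_coeff11 (i j : Fin n) : G.fund.coeff11 e y i j = Complex.I * G.h e y i j := by
  have h : ∀ u v, G.fund.rep e y ![u, v] = (G.gRep e y (Complex.I • u) v : ℂ) := by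
    intro u v
    change ((G.g (e.symm y) (Complex.I • cframe e y u) (frame e y v) : ℝ) : ℂ) = _
    rw [← map_smul]
    rfl
  simp only [Form.coeff11, mixedComp, h, h_apply, hForm, gRep_J_left, gRep_J_J_right]
  push_cast
  linear_combination (-(1 / 2) * G.gRep e y (dx i) (Complex.I • dx j)) * Complex.I_sq

theorem ricci1_eq (i j : Fin n) :
    G.ricci1 e y i j = Complex.I * G.tr e y (fun k l => G.R e y i j k l) := rfl

theorem ricci2_eq (i j : Fin n) :
    G.ricci2 e y i j = Complex.I * G.tr e y (fun k l => G.R e y k l i j) := rfl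

theorem tr_mul_h (he : e ∈ coords n M) (hy : y ∈ e.target) (c : ℂ) :
    G.tr e y (fun k l => c * G.h e y k l) = c * n :=
  (G.tr_mul_left c (G.h e y)).trans (by rw [G.tr_h he hy])

theorem scal_eq :
    G.scal e y = G.tr e y (fun i j => G.tr e y (fun k l => G.R e y i j k l)) := by
  simp only [scal, tr, Finset.mul_sum, mul_assoc]

theorem scalHat_eq :
    G.scalHat e y = G.tr e y (fun i j => G.tr e y (fun k l => G.R e y k j i l)) := by
  simp only [scalHat, tr, Finset.mul_sum]
  -- Exchanging the names of i and k turns the contraction pattern of ŝ into a double trace.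
  have h : ∀ f : Fin n → Fin n → Fin n → Fin n → ℂ,
      ∑ i, ∑ j, ∑ k, ∑ l, f i j k l = ∑ k, ∑ j, ∑ i, ∑ l, f i j k l := by
    intro f
    rw [Finset.sum_comm]
    have h1 : ∀ j, ∑ i, ∑ k, ∑ l, f i j k l = ∑ k, ∑ i, ∑ l, f i j k l := fun j =>
      Finset.sum_comm
    simp only [h1]
    exact Finset.sum_comm
  rw [h]
  refine Finset.sum_congr rfl fun i _ => Finset.sum_congr rfl fun j _ =>
    Finset.sum_congr rfl fun k _ => Finset.sum_congr rfl fun l _ => by ring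

/-- The left side is the coefficient of ∂∂*ω once ∂*ω = -√-1 τ̄ is known. The right side is the
conjugate of `wirtBar_torsionTrace`, using conj R_{ij̄kl̄} = R_{jīlk̄}. -/
theorem wirt_conj_torsionTrace (he : e ∈ coords n M) (hy : y ∈ e.target) (i j : Fin n) :
    wirt i (fun x => -Complex.I * conj (G.torsionTrace e x j)) y =
      -Complex.I * (G.tr e y (fun k l => G.R e y i l k j) -
        G.tr e y (fun k l => G.R e y i j k l)) := by
  have hd : DifferentiableAt ℝ (fun x => G.torsionTrace e x j) y :=
    (G.contDiffOn_torsionTrace he j).differentiableAt_of_isOpen e.open_target hy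
  rw [wirt_const_mul i _ hd.conj_comp, wirt_conj i hd, G.wirtBar_torsionTrace he hy, map_sub,
    G.tr_conj he hy, G.tr_conj he hy]
  simp only [G.R_conj he hy]

end Identities

/-! ### The pointwise identity on surfaces. -/

section Surface

/-- The summand on the left is antisymmetric in i, k and in j, l. For two-valued indices it is a
scalar times ε_{ik} ε_{jl}, and contracting ε ⊗ ε with the inverse of h gives h divided by its
determinant. -/
theorem trace_antisymmetrized_fin_two (h : Matrix (Fin 2) (Fin 2) ℂ) (h0 : h.det ≠ 0)
    (R : Fin 2 → Fin 2 → Fin 2 → Fin 2 → ℂ) (i j : Fin 2) :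
    ∑ k, ∑ l, h⁻¹ l k * (R i j k l + R k l i j - R k j i l - R i l k j) =
      (∑ a, ∑ b, h⁻¹ b a * ∑ k, ∑ l, h⁻¹ l k * (R a b k l - R k b a l)) * h i j := by
  rw [Matrix.inv_def, Matrix.adjugate_fin_two, Ring.inverse_eq_inv']
  have hd := Matrix.det_fin_two h
  set D := h.det
  have hD : D⁻¹ * (h 0 0 * h 1 1 - h 0 1 * h 1 0) = 1 := by
    rw [← hd, inv_mul_cancel₀ h0]
  generalize D⁻¹ = c at hD ⊢
  -- The left side is linear in c = 1/det h and the right side quadratic. They differ by a multiple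
  -- of c · det h - 1, with the unique independent component of the antisymmetrized tensor as a
  -- factor.
  fin_cases i <;> fin_cases j <;> simp [Fin.sum_univ_two]
  · linear_combination (-c * h 0 0 * (R 0 0 1 1 + R 1 1 0 0 - R 1 0 0 1 - R 0 1 1 0)) * hD
  · linear_combination (-c * h 0 1 * (R 0 0 1 1 + R 1 1 0 0 - R 1 0 0 1 - R 0 1 1 0)) * hD
  · linear_combination (-c * h 1 0 * (R 0 0 1 1 + R 1 1 0 0 - R 1 0 0 1 - R 0 1 1 0)) * hD
  · linear_combination (-c * h 1 1 * (R 0 0 1 1 + R 1 1 0 0 - R 1 0 0 1 - R 0 1 1 0)) * hD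

variable {M : Type*} [TopologicalSpace M] [ChartedSpace (Cn 2) M]
  [IsManifold 𝓘(ℂ, Cn 2) ω M] {e : OpenPartialHomeomorph M (Cn 2)} {y : Cn 2}
  (G : HermitianMetric 2 M)

theorem ricci_sub_of_surface (he : e ∈ coords 2 M) (hy : y ∈ e.target) (i j : Fin 2) :
    G.ricci1 e y i j - G.ricci2 e y i j =
      (G.scalHat e y - G.scal e y) * G.fund.coeff11 e y i j
        + wirt i (fun x => -Complex.I * conj (G.torsionTrace e x j)) y
        - conj (wirt j (fun x => -Complex.I * conj (G.torsionTrace e x i)) y) := by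
  have h := trace_antisymmetrized_fin_two (G.h e y) (G.isUnit_det_h he hy).ne_zero (G.R e y) i j
  have h' : G.tr e y (fun k l => G.R e y i j k l + G.R e y k l i j - G.R e y k j i l
        - G.R e y i l k j) =
      G.tr e y (fun a b => G.tr e y (fun k l => G.R e y a b k l - G.R e y k b a l)) *
        G.h e y i j := h
  simp only [tr_sub, tr_add] at h'
  rw [G.wirt_conj_torsionTrace he hy, G.wirt_conj_torsionTrace he hy, map_mul, map_sub,
    G.tr_conj he hy, G.tr_conj he hy, ricci1_eq, ricci2_eq, scal_eq, scalHat_eq, fund_coeff11]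
  simp only [G.R_conj he hy, map_neg, Complex.conj_I]
  linear_combination -Complex.I * h'

end Surface

/-! ### The pointwise identity for locally conformally Kähler metrics. -/

section LCK

set_option linter.unusedSectionVars false

variable {n : ℕ} {M : Type*} [TopologicalSpace M] [ChartedSpace (Cn n) M]
  [IsManifold 𝓘(ℂ, Cn n) ω M] {e e' : OpenPartialHomeomorph M (Cn n)} {y : Cn n}
  (G : HermitianMetric n M)

/-- The trace of a_k h_{ab̄} is n a_k, and that of a_a h_{kb̄} is a_k. -/
theorem torsionTrace_of_lck (he : e ∈ coords n M) (hy : y ∈ e.target) {a : Fin n → ℂ}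
    (hT : ∀ i j l, wirt i (fun x => G.h e x j l) y - wirt j (fun x => G.h e x i l) y =
      a i * G.h e y j l - a j * G.h e y i l) (k : Fin n) :
    G.torsionTrace e y k = (n - 1) * a k := by
  rw [torsionTrace_eq_tr]
  simp only [hT]
  rw [tr_sub, G.tr_mul_h he hy, G.tr_h_row he hy]
  ring

/-- Raising an index in `hT` gives Γ_{ik}^p - Γ_{ki}^p = a_i δ_{pk} - a_k δ_{pi}. As δ is constant,
∂_j̄ falls only on a. The hypothesis is needed on the whole chart because it gets differentiated. -/
theorem R_sub_of_lck (he : e ∈ coords n M) (hy : y ∈ e.target) {a : Fin n → Cn n → ℂ}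
    (ha : ∀ i, DifferentiableAt ℝ (a i) y)
    (hT : ∀ x ∈ e.target, ∀ i j l, wirt i (fun x => G.h e x j l) x -
      wirt j (fun x => G.h e x i l) x = a i x * G.h e x j l - a j x * G.h e x i l)
    (i j k l : Fin n) :
    G.R e y k j i l - G.R e y i j k l =
      wirtBar j (a i) y * G.h e y k l - wirtBar j (a k) y * G.h e y i l := by
  have h1 : ∀ p, wirtBar j (fun x => G.Γ e x i k p) y - wirtBar j (fun x => G.Γ e x k i p) y =
      (if p = k then 1 else 0) * wirtBar j (a i) y -
        (if p = i then 1 else 0) * wirtBar j (a k) y := by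
    intro p
    rw [← wirtBar_sub j (G.differentiableAt_Γ he hy i k p) (G.differentiableAt_Γ he hy k i p),
      ← wirtBar_const_mul j _ (ha i), ← wirtBar_const_mul j _ (ha k),
      ← wirtBar_sub j ((ha i).const_mul _) ((ha k).const_mul _)]
    refine wirtBar_congr j ?_
    filter_upwards [e.open_target.mem_nhds hy] with x hx
    simp only [Γ, ← Finset.sum_sub_distrib, ← mul_sub, hT x hx]
    simp only [mul_sub, Finset.sum_sub_distrib, mul_left_comm (G.hInv _ _ _ _), ← Finset.mul_sum,
      G.sum_hInv_mul_h he hx]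
    ring
  have h2 : ∀ p, G.h e y p l * wirtBar j (fun x => G.Γ e x i k p) y -
      G.h e y p l * wirtBar j (fun x => G.Γ e x k i p) y =
      (if p = k then G.h e y p l * wirtBar j (a i) y else 0) -
        (if p = i then G.h e y p l * wirtBar j (a k) y else 0) := by
    intro p
    rw [← mul_sub, h1]
    split_ifs <;> ring
  simp only [R]
  rw [neg_sub_neg, ← Finset.sum_sub_distrib]
  simp only [h2, Finset.sum_sub_distrib, Finset.sum_ite_eq', Finset.mem_univ, if_true]
  ring

theorem ricci_sub_of_lck (hn : 2 ≤ n) (he : e ∈ coords n M) (hy : y ∈ e.target)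
    {a : Fin n → Cn n → ℂ} (ha : ∀ i, DifferentiableAt ℝ (a i) y)
    (hT : ∀ x ∈ e.target, ∀ i j l, wirt i (fun x => G.h e x j l) x -
      wirt j (fun x => G.h e x i l) x = a i x * G.h e x j l - a j x * G.h e x i l)
    (hb : ∀ i j, wirtBar j (a i) y = conj (wirtBar i (a j) y)) (i j : Fin n) :
    G.ricci1 e y i j - G.ricci2 e y i j =
      (1 / ((n : ℂ) - 1)) * ((G.scalHat e y - G.scal e y) * G.fund.coeff11 e y i j
        + n * wirt i (fun x => -Complex.I * conj (G.torsionTrace e x j)) y) := by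
  have hR := G.R_sub_of_lck he hy ha hT
  -- Conjugating `hR` swaps barred and unbarred indices; `hb`, the closedness of θ, turns the
  -- conjugates of ∂̄a back into ∂̄a.
  have hR' : ∀ i j k l, G.R e y i l k j - G.R e y i j k l =
      wirtBar j (a i) y * G.h e y k l - wirtBar l (a i) y * G.h e y k j := by
    intro i j k l
    have h := congrArg conj (hR j i l k)
    simp only [map_sub, map_mul, G.R_conj he hy, h_conj, ← hb] at h
    exact h
  have h1 : G.tr e y (fun k l => G.R e y i j k l) - G.tr e y (fun k l => G.R e y k l i j) =
      G.h e y i j * G.tr e y (fun k l => wirtBar l (a k) y) - wirtBar j (a i) y * n := by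
    rw [← G.tr_mul_h he hy, ← tr_mul_left, ← tr_sub, ← tr_sub]
    refine congrArg _ (funext₂ fun k l => ?_)
    -- The path from R_{ij̄kl̄} to R_{kl̄ij̄} passes through R_{kj̄il̄}: the unbarred indices are
    -- exchanged first, then the barred ones. The terms ∂_j̄ a_k · h_{il̄} cancel.
    linear_combination -hR i j k l - hR' k j i l
  have h2 : G.scalHat e y - G.scal e y =
      (n - 1) * G.tr e y (fun k l => wirtBar l (a k) y) := by
    rw [scal_eq, scalHat_eq, ← tr_sub]
    simp only [← tr_sub, hR]
    simp only [tr_sub, G.tr_mul_h he hy, G.tr_h_row he hy (fun k => wirtBar _ (a k) y)]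
    simp only [← tr_mul_left, ← tr_sub]
    exact congrArg _ (funext₂ fun k l => by ring)
  have h3 : wirt i (fun x => -Complex.I * conj (G.torsionTrace e x j)) y =
      -Complex.I * ((n - 1) * wirtBar j (a i) y) := by
    have h4 : wirt i (fun x => -Complex.I * conj (G.torsionTrace e x j)) y =
        wirt i (fun x => (-Complex.I * (n - 1)) * conj (a j x)) y := by
      refine wirt_congr i ?_
      filter_upwards [e.open_target.mem_nhds hy] with x hx
      rw [G.torsionTrace_of_lck he hx (a := fun i => a i x) (hT x hx)]
      simp
      ring
    rw [h4, wirt_const_mul i _ (ha j).conj_comp, wirt_conj i (ha j), ← hb]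
    ring
  have hn' : (n : ℂ) - 1 ≠ 0 := by
    rw [sub_ne_zero]
    exact_mod_cast (by omega : n ≠ 1)
  rw [ricci1_eq, ricci2_eq, fund_coeff11, h2, h3, ← mul_sub, h1]
  field_simp
  ring

end LCK

end HermitianMetric

/-! ### Smoothness of form-valued maps, and (0,1)-forms under coordinate changes. -/

section AlternatingMaps

variable {n : ℕ} {𝕂 : Type*} [NormedAddCommGroup 𝕂] [NormedSpace ℝ 𝕂] [FiniteDimensional ℝ 𝕂]
  {k : ℕ} {U : Set (Cn n)}

/-- Evaluation on tuples of basis vectors is an injective linear map into a finite-dimensional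
space. Its linear left inverse recovers f from finitely many smooth functions. -/
theorem contDiffOn_of_apply {f : Cn n → Cn n [⋀^Fin k]→L[ℝ] 𝕂}
    (h : ∀ v, ContDiffOn ℝ ∞ (fun y => f y v) U) : ContDiffOn ℝ ∞ f U := by
  let b := Module.finBasis ℝ (Cn n)
  let L : (Cn n [⋀^Fin k]→L[ℝ] 𝕂) →ₗ[ℝ]
      ((Fin k → Fin (Module.finrank ℝ (Cn n))) → 𝕂) :=
    { toFun := fun α v => α fun i => b (v i)
      map_add' := fun _ _ => rfl
      map_smul' := fun _ _ => rfl }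
  have hL : LinearMap.ker L = ⊥ := by
    rw [LinearMap.ker_eq_bot]
    intro α β hαβ
    refine ContinuousAlternatingMap.toAlternatingMap_injective ?_
    refine AlternatingMap.coe_multilinearMap_injective ?_
    exact Module.Basis.ext_multilinear (fun _ => b) fun v => congrFun hαβ v
  obtain ⟨l, hl⟩ := L.exists_leftInverse_of_injective hL
  have h1 : ContDiffOn ℝ ∞ (fun y => L (f y)) U := contDiffOn_pi.2 fun v => h _
  have h2 := (LinearMap.toContinuousLinearMap l).contDiff.comp_contDiffOn h1
  refine h2.congr fun y _ => ?_
  exact (LinearMap.congr_fun hl (f y)).symm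

omit [FiniteDimensional ℝ 𝕂] in
theorem contDiffOn_apply {f : Cn n → Cn n [⋀^Fin k]→L[ℝ] 𝕂} (h : ContDiffOn ℝ ∞ f U)
    (v : Fin k → Cn n) : ContDiffOn ℝ ∞ (fun y => f y v) U := by
  let A : (Cn n [⋀^Fin k]→L[ℝ] 𝕂) →L[ℝ] 𝕂 :=
    (ContinuousMultilinearMap.apply ℝ (fun _ : Fin k => Cn n) 𝕂 v).comp
      (ContinuousAlternatingMap.toContinuousMultilinearMapCLM ℝ)
  exact A.contDiff.comp_contDiffOn h

end AlternatingMaps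

section Forms01

set_option linter.unusedSectionVars false

variable {n : ℕ} {M : Type*} [TopologicalSpace M] [ChartedSpace (Cn n) M]
  {e e' : OpenPartialHomeomorph M (Cn n)} {y : Cn n} {α : Form n M ℂ 1}

theorem Form.IsSmooth01.rep_I_smul (hα : α.IsSmooth01) (v : Cn n) :
    α.rep e y ![Complex.I • v] = -(Complex.I * α.rep e y ![v]) := by
  have h := hα.2 (e.symm y) (cframe e y v)
  have h1 : ∀ w : Cn n, α.rep e y ![w] = α (e.symm y) ![cframe e y w] := by
    intro w
    change α (e.symm y) _ = _
    congr 1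
    ext i
    fin_cases i
    rfl
  rw [h1, h1, map_smul]
  exact h

theorem Form.IsSmooth01.coeffBar_eq (hα : α.IsSmooth01) (j : Fin n) :
    α.coeffBar e y j = α.rep e y ![dx j] := by
  rw [Form.coeffBar, hα.rep_I_smul]
  linear_combination (-(1 / 2) * α.rep e y ![dx j]) * Complex.I_sq

theorem Form.IsSmooth01.rep_eq (hα : α.IsSmooth01) (v : Cn n) :
    α.rep e y ![v] = ∑ j, α.coeffBar e y j * conj (v j) := by
  let L : Cn n →L[ℝ] ℂ := (ContinuousAlternatingMap.ofSubsingleton ℝ (Cn n) ℂ (0 : Fin 1)).symm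
    (α.rep e y)
  have hL : ∀ w, L w = α.rep e y ![w] := by
    intro w
    change α.rep e y (fun _ => w) = _
    congr 1
    ext i
    fin_cases i
    rfl
  rw [← hL, real_linear_apply]
  simp only [hL, hα.rep_I_smul, hα.coeffBar_eq]
  refine Finset.sum_congr rfl fun a _ => ?_
  linear_combination ((1 / 2) * α.rep e y ![dx a] * (v a - conj (v a))) * Complex.I_sq

theorem Form.IsSmooth01.contDiffOn_coeffBar (hα : α.IsSmooth01) (he : e ∈ coords n M)
    (j : Fin n) : ContDiffOn ℝ ∞ (fun y => α.coeffBar e y j) e.target := by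
  simp only [hα.coeffBar_eq]
  exact contDiffOn_apply (hα.1 e he) _

theorem Form.IsSmooth01.differentiableAt_coeffBar (hα : α.IsSmooth01) (he : e ∈ coords n M)
    (hy : y ∈ e.target) (j : Fin n) : DifferentiableAt ℝ (fun y => α.coeffBar e y j) y :=
  (hα.contDiffOn_coeffBar he j).differentiableAt_of_isOpen e.open_target hy

variable [IsManifold 𝓘(ℂ, Cn n) ω M]

theorem Form.IsSmooth01.coeffBar_trans (hα : α.IsSmooth01) (he : e ∈ coords n M)
    (he' : e' ∈ coords n M) (hy : y ∈ overlap e e') (j : Fin n) :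
    α.coeffBar e y j = ∑ b, conj (jac e e' y b j) * α.coeffBar e' (trans e e' y) b := by
  rw [hα.coeffBar_eq, α.rep_trans he he' hy]
  have h : (fun i => fderiv ℂ (trans e e') y (![dx j] i)) =
      ![fderiv ℂ (trans e e') y (dx j)] := by
    ext i
    fin_cases i
    rfl
  rw [h, hα.rep_eq]
  exact Finset.sum_congr rfl fun b _ => mul_comm _ _

theorem contDiffOn_jac (he : e ∈ coords n M) (he' : e' ∈ coords n M) :
    ContDiffOn ℂ ω (fderiv ℂ (trans e e')) (overlap e e') :=
  (contDiffOn_trans he he').fderiv_of_isOpen isOpen_overlap (by simp)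

theorem differentiableAt_fderiv_trans (he : e ∈ coords n M) (he' : e' ∈ coords n M)
    (hy : y ∈ overlap e e') : DifferentiableAt ℂ (fderiv ℂ (trans e e')) y :=
  ((contDiffOn_jac he he').differentiableOn (by simp)).differentiableAt (overlap_mem_nhds hy)

theorem hasFDerivAt_jac (he : e ∈ coords n M) (he' : e' ∈ coords n M)
    (hy : y ∈ overlap e e') (a i : Fin n) : HasFDerivAt (𝕜 := ℂ) (fun x => jac e e' x a i)
      (((ContinuousLinearMap.proj a).comp
        (ContinuousLinearMap.apply ℂ (Cn n) (dx i : Cn n))).comp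
          (fderiv ℂ (fderiv ℂ (trans e e')) y)) y :=
  ((ContinuousLinearMap.proj (R := ℂ) (φ := fun _ : Fin n => ℂ) a).comp
    (ContinuousLinearMap.apply ℂ (Cn n) (dx i : Cn n))).hasFDerivAt.comp y
      (differentiableAt_fderiv_trans he he' hy).hasFDerivAt

theorem differentiableAt_jac (he : e ∈ coords n M) (he' : e' ∈ coords n M)
    (hy : y ∈ overlap e e') (a i : Fin n) : DifferentiableAt ℂ (fun x => jac e e' x a i) y :=
  (hasFDerivAt_jac he he' hy a i).differentiableAt

/-- Both sides are second derivatives of the same holomorphic coordinate change. -/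
theorem wirt_jac_symm (he : e ∈ coords n M) (he' : e' ∈ coords n M)
    (hy : y ∈ overlap e e') (a i k : Fin n) :
    wirt k (fun x => jac e e' x a i) y = wirt i (fun x => jac e e' x a k) y := by
  rw [wirt_of_holomorphic k (differentiableAt_jac he he' hy a i),
    wirt_of_holomorphic i (differentiableAt_jac he he' hy a k),
    (hasFDerivAt_jac he he' hy a i).fderiv, (hasFDerivAt_jac he he' hy a k).fderiv]
  have hs : IsSymmSndFDerivAt ℂ (trans e e') y :=
    ((contDiffOn_trans he he').contDiffAt (overlap_mem_nhds hy)).isSymmSndFDerivAt (by simp)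
  exact congrFun (hs.eq (dx k) (dx i)) a

theorem wirt_conj_jac (he : e ∈ coords n M) (he' : e' ∈ coords n M)
    (hy : y ∈ overlap e e') (a i k : Fin n) :
    wirt k (fun x => conj (jac e e' x a i)) y = 0 := by
  rw [wirt_conj k ((differentiableAt_jac he he' hy a i).restrictScalars ℝ),
    wirtBar_of_holomorphic k (differentiableAt_jac he he' hy a i), map_zero]

theorem wirt_comp_trans {f : Cn n → ℂ} (he : e ∈ coords n M) (he' : e' ∈ coords n M)
    (hy : y ∈ overlap e e') (hf : DifferentiableAt ℝ f (trans e e' y)) (i : Fin n) :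
    wirt i (fun x => f (trans e e' x)) y = ∑ a, jac e e' y a i * wirt a f (trans e e' y) :=
  wirt_comp_holomorphic i (differentiableAt_trans he he' hy) hf

theorem differentiableAt_comp_trans {f : Cn n → ℂ} (he : e ∈ coords n M) (he' : e' ∈ coords n M)
    (hy : y ∈ overlap e e') (hf : DifferentiableAt ℝ f (trans e e' y)) :
    DifferentiableAt ℝ (fun x => f (trans e e' x)) y :=
  hf.comp y ((differentiableAt_trans he he' hy).restrictScalars ℝ)

/-- The coefficients transform by the conjugate Jacobian, which is antiholomorphic and hence killed
by ∂/∂zⁱ. So ∂α transforms as a tensor. -/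
theorem Form.IsSmooth01.del_trans (hα : α.IsSmooth01) (he : e ∈ coords n M)
    (he' : e' ∈ coords n M) (hy : y ∈ overlap e e') :
    α.del e y = (jac e e' y).transpose * Matrix.of (α.del e' (trans e e' y)) *
      (jac e e' y).map conj := by
  ext i j
  have hj : ∀ b, DifferentiableAt ℝ (fun x => conj (jac e e' x b j)) y := fun b =>
    ((differentiableAt_jac he he' hy b j).restrictScalars ℝ).conj_comp
  have hd : ∀ b, DifferentiableAt ℝ (fun x => α.coeffBar e' x b) (trans e e' y) := fun b =>
    hα.differentiableAt_coeffBar he' (trans_mem_overlap hy).1 b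
  have h1 : α.del e y i j =
      wirt i (fun x => ∑ b, conj (jac e e' x b j) * α.coeffBar e' (trans e e' x) b) y := by
    refine wirt_congr i ?_
    filter_upwards [overlap_mem_nhds hy] with x hx
    exact hα.coeffBar_trans he he' hx j
  rw [h1, wirt_sum _ _ fun b _ => (hj b).fun_mul (differentiableAt_comp_trans he he' hy (hd b))]
  simp only [wirt_mul i (hj _) (differentiableAt_comp_trans he he' hy (hd _)),
    wirt_conj_jac he he' hy, wirt_comp_trans he he' hy (hd _), Matrix.mul_apply,
    Matrix.transpose_apply, Matrix.map_apply, Matrix.of_apply, Form.del]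
  exact Finset.sum_congr rfl fun b _ => by ring

end Forms01

/-! ### The torsion trace as a global smooth (0,1)-form. -/

namespace HermitianMetric

section Torsion

set_option linter.unusedSectionVars false

variable {n : ℕ} {M : Type*} [TopologicalSpace M] [ChartedSpace (Cn n) M]
  [IsManifold 𝓘(ℂ, Cn n) ω M] {e e' : OpenPartialHomeomorph M (Cn n)} {y : Cn n}
  (G : HermitianMetric n M)

theorem wirt_h_trans (he : e ∈ coords n M) (he' : e' ∈ coords n M) (hy : y ∈ overlap e e')
    (k a b : Fin n) :
    wirt k (fun x => G.h e x a b) y = ∑ d, (∑ c,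
      (wirt k (fun x => jac e e' x c a) y * G.h e' (trans e e' y) c d +
        jac e e' y c a * ∑ m, jac e e' y m k *
          wirt m (fun x => G.h e' x c d) (trans e e' y))) * conj (jac e e' y d b) := by
  have hj : ∀ c a, DifferentiableAt ℝ (fun x => jac e e' x c a) y := fun c a =>
    (differentiableAt_jac he he' hy c a).restrictScalars ℝ
  have hd : ∀ c d, DifferentiableAt ℝ (fun x => G.h e' x c d) (trans e e' y) := fun c d =>
    G.differentiableAt_h he' (trans_mem_overlap hy).1 c d
  have hd' := fun c d => differentiableAt_comp_trans he he' hy (hd c d)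
  have h1 : wirt k (fun x => G.h e x a b) y = wirt k (fun x => ∑ d,
      (∑ c, jac e e' x c a * G.h e' (trans e e' x) c d) * conj (jac e e' x d b)) y := by
    refine wirt_congr k ?_
    filter_upwards [overlap_mem_nhds hy] with x hx
    rw [G.h_trans he he' hx]
    simp only [Matrix.mul_apply, Matrix.transpose_apply, Matrix.map_apply]
  have h2 : ∀ d, DifferentiableAt ℝ
      (fun x => ∑ c, jac e e' x c a * G.h e' (trans e e' x) c d) y := fun d =>
    DifferentiableAt.fun_sum fun c _ => (hj c a).fun_mul (hd' c d)
  rw [h1, wirt_sum _ _ fun d _ => (h2 d).fun_mul (hj d b).conj_comp]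
  refine Finset.sum_congr rfl fun d _ => ?_
  rw [wirt_mul k (h2 d) (hj d b).conj_comp, wirt_conj_jac he he' hy, mul_zero, zero_add,
    wirt_sum _ _ fun c _ => (hj c a).fun_mul (hd' c d)]
  congr 1
  refine Finset.sum_congr rfl fun c _ => ?_
  rw [wirt_mul k (hj c a) (hd' c d), wirt_comp_trans he he' hy (hd c d)]
  ring

/-- Derivatives of h pick up second derivatives of the coordinate change. These are symmetric in k
and a and drop out of the antisymmetrization that defines the torsion; what remains is tensorial. -/
theorem torsionTrace_trans (he : e ∈ coords n M) (he' : e' ∈ coords n M)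
    (hy : y ∈ overlap e e') (k : Fin n) :
    G.torsionTrace e y k =
      ∑ m, jac e e' y m k * G.torsionTrace e' (trans e e' y) m := by
  let X : Fin n → Matrix (Fin n) (Fin n) ℂ := fun m => Matrix.of fun c d =>
    wirt m (fun x => G.h e' x c d) (trans e e' y) - wirt c (fun x => G.h e' x m d) (trans e e' y)
  have h1 : (fun a b => wirt k (fun x => G.h e x a b) y - wirt a (fun x => G.h e x k b) y) =
      (jac e e' y).transpose * (∑ m, jac e e' y m k • X m) * (jac e e' y).map conj := by
    ext a b
    rw [G.wirt_h_trans he he' hy, G.wirt_h_trans he he' hy]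
    simp only [Matrix.mul_apply, Matrix.transpose_apply, Matrix.map_apply, Matrix.sum_apply,
      Matrix.smul_apply, smul_eq_mul, X, Matrix.of_apply]
    rw [← Finset.sum_sub_distrib]
    refine Finset.sum_congr rfl fun d _ => ?_
    rw [← sub_mul]
    congr 1
    simp only [Finset.sum_add_distrib, wirt_jac_symm he he' hy _ k a, add_sub_add_left_eq_sub,
      mul_sub, Finset.mul_sum, Finset.sum_sub_distrib]
    congr 1
    rw [Finset.sum_comm]
    exact Finset.sum_congr rfl fun m _ => Finset.sum_congr rfl fun c _ => by ring
  have h2 : ∀ m, G.torsionTrace e' (trans e e' y) m = G.tr e' (trans e e' y) (X m) := fun m =>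
    G.torsionTrace_eq_tr m
  rw [torsionTrace_eq_tr, h1, G.tr_trans he he' hy, tr_eq_trace, Matrix.mul_sum,
    Matrix.trace_sum]
  refine Finset.sum_congr rfl fun m _ => ?_
  rw [h2, tr_eq_trace, Matrix.mul_smul, Matrix.trace_smul, smul_eq_mul]

/-- The `(0,1)`-form `-√-1 τ̄`, where `τ` is the trace of the torsion. -/
def torsionForm : Form n M ℂ 1 := fun p =>
  ContinuousAlternatingMap.ofSubsingleton ℝ (Cn n) ℂ (0 : Fin 1)
    (∑ k, (-Complex.I * conj (G.torsionTrace (chartAt (Cn n) p) (chartAt (Cn n) p p) k)) •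
      ((Complex.conjCLE : ℂ →L[ℝ] ℂ).comp (ContinuousLinearMap.proj k : Cn n →L[ℝ] ℂ)))

theorem torsionForm_apply (p : M) (v : Fin 1 → Cn n) :
    (G.torsionForm p : Cn n [⋀^Fin 1]→L[ℝ] ℂ) v =
      ∑ k, -Complex.I * conj (G.torsionTrace (chartAt (Cn n) p) (chartAt (Cn n) p p) k) *
        conj (v 0 k) := by
  change (∑ k, (-Complex.I * conj (G.torsionTrace (chartAt (Cn n) p) (chartAt (Cn n) p p) k)) •
    ((Complex.conjCLE : ℂ →L[ℝ] ℂ).comp (ContinuousLinearMap.proj k : Cn n →L[ℝ] ℂ)) :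
      Cn n →L[ℝ] ℂ) (v 0) = _
  rw [_root_.sum_apply]
  rfl

theorem torsionForm_rep (he : e ∈ coords n M) (hy : y ∈ e.target) (v : Fin 1 → Cn n) :
    G.torsionForm.rep e y v =
      ∑ j, -Complex.I * conj (G.torsionTrace e y j) * conj (v 0 j) := by
  have h1 : G.torsionForm.rep e y v =
      (G.torsionForm (e.symm y) : Cn n [⋀^Fin 1]→L[ℝ] ℂ) fun i => cframe e y (v i) := rfl
  have hc := chartAt_mem_coords (n := n) (e.symm y)
  have hy' := mem_overlap_chartAt (n := n) hy
  rw [h1, torsionForm_apply, cframe_eq he hy]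
  change ∑ k, -Complex.I * conj (G.torsionTrace _ (trans e _ y) k) * _ = _
  simp only [fderiv_trans_apply, G.torsionTrace_trans he hc hy', map_sum, map_mul,
    Finset.mul_sum, Finset.sum_mul]
  rw [Finset.sum_comm]
  exact Finset.sum_congr rfl fun m _ => Finset.sum_congr rfl fun c _ => by ring

theorem torsionForm_isSmooth01 : G.torsionForm.IsSmooth01 := by
  refine ⟨fun e he => contDiffOn_of_apply fun v => ?_, fun p v => ?_⟩
  · refine ContDiffOn.congr ?_ fun y hy => G.torsionForm_rep he hy v
    exact ContDiffOn.sum fun j _ => (contDiffOn_const.mul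
      (contDiffOn_conj (G.contDiffOn_torsionTrace he j))).mul contDiffOn_const
  · have h : ∀ w : Cn n, (G.torsionForm p : Cn n [⋀^Fin 1]→L[ℝ] ℂ) ![Complex.I • w] =
        -(Complex.I * (G.torsionForm p : Cn n [⋀^Fin 1]→L[ℝ] ℂ) ![w]) := by
      intro w
      refine ((G.torsionForm_apply p ![Complex.I • w]).trans ?_).trans
        (congrArg (fun z => -(Complex.I * z)) (G.torsionForm_apply p ![w])).symm
      rw [Finset.mul_sum, ← Finset.sum_neg_distrib]
      refine Finset.sum_congr rfl fun k _ => ?_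
      rw [Matrix.cons_val_zero, Matrix.cons_val_zero, Pi.smul_apply, smul_eq_mul, map_mul,
        Complex.conj_I]
      ring
    exact h v

theorem torsionForm_coeffBar (he : e ∈ coords n M) (hy : y ∈ e.target) (j : Fin n) :
    G.torsionForm.coeffBar e y j = -Complex.I * conj (G.torsionTrace e y j) := by
  rw [G.torsionForm_isSmooth01.coeffBar_eq, G.torsionForm_rep he hy]
  simp [dx, Pi.single_apply, apply_ite conj]

end Torsion

end HermitianMetric

/-! ### The (1,0)-part of a closed real 1-form. -/

theorem fderiv_ofReal_apply {n : ℕ} {f : Cn n → ℝ} {y : Cn n} (hf : DifferentiableAt ℝ f y)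
    (u : Cn n) : fderiv ℝ (fun x => (f x : ℂ)) y u = (fderiv ℝ f y u : ℝ) := by
  have h : HasFDerivAt (fun x => (f x : ℂ)) (Complex.ofRealCLM.comp (fderiv ℝ f y)) y :=
    Complex.ofRealCLM.hasFDerivAt.comp y hf.hasFDerivAt
  rw [h.fderiv]
  rfl

/-- The entries of h have the form ½(f + c g) with f and g real; this reduces their Wirtinger
derivatives to real directional ones. -/
theorem wirt_ofReal_add {n : ℕ} {f g : Cn n → ℝ} {y : Cn n} (hf : DifferentiableAt ℝ f y)
    (hg : DifferentiableAt ℝ g y) (i : Fin n) (c : ℂ) :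
    wirt i (fun x => (1 / 2) * ((f x : ℂ) + c * (g x : ℂ))) y =
      (1 / 4) * ((fderiv ℝ f y (dx i) : ℂ) - Complex.I * fderiv ℝ f y (Complex.I • dx i)
        + c * (fderiv ℝ g y (dx i) - Complex.I * fderiv ℝ g y (Complex.I • dx i))) := by
  have hf' : DifferentiableAt ℝ (fun x => (f x : ℂ)) y :=
    Complex.ofRealCLM.differentiableAt.comp y hf
  have hg' : DifferentiableAt ℝ (fun x => (g x : ℂ)) y :=
    Complex.ofRealCLM.differentiableAt.comp y hg
  rw [wirt_const_mul i _ (hf'.fun_add (hg'.const_mul c)), wirt_add i hf' (hg'.const_mul c),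
    wirt_const_mul i _ hg', wirt, wirt]
  simp only [fderiv_ofReal_apply hf, fderiv_ofReal_apply hg]
  ring

theorem wirtBar_ofReal_add {n : ℕ} {f g : Cn n → ℝ} {y : Cn n} (hf : DifferentiableAt ℝ f y)
    (hg : DifferentiableAt ℝ g y) (i : Fin n) (c : ℂ) :
    wirtBar i (fun x => (1 / 2) * ((f x : ℂ) + c * (g x : ℂ))) y =
      (1 / 4) * ((fderiv ℝ f y (dx i) : ℂ) + Complex.I * fderiv ℝ f y (Complex.I • dx i)
        + c * (fderiv ℝ g y (dx i) + Complex.I * fderiv ℝ g y (Complex.I • dx i))) := by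
  have hf' : DifferentiableAt ℝ (fun x => (f x : ℂ)) y :=
    Complex.ofRealCLM.differentiableAt.comp y hf
  have hg' : DifferentiableAt ℝ (fun x => (g x : ℂ)) y :=
    Complex.ofRealCLM.differentiableAt.comp y hg
  rw [wirtBar_const_mul i _ (hf'.fun_add (hg'.const_mul c)), wirtBar_add i hf' (hg'.const_mul c),
    wirtBar_const_mul i _ hg', wirtBar, wirtBar]
  simp only [fderiv_ofReal_apply hf, fderiv_ofReal_apply hg]
  ring

section RealOneForms

set_option linter.unusedSectionVars false

variable {n : ℕ} {M : Type*} [TopologicalSpace M] [ChartedSpace (Cn n) M]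
  {e : OpenPartialHomeomorph M (Cn n)} {y : Cn n} {θ : Form n M ℝ 1}

/-- The coefficient `θ(∂/∂zⁱ)` of `dzⁱ` in a real 1-form. -/
def realCoeff (θ : Form n M ℝ 1) (e : OpenPartialHomeomorph M (Cn n)) (i : Fin n) (y : Cn n) :
    ℂ :=
  (1 / 2) * ((θ.rep e y ![dx i] : ℂ) + (-Complex.I) * (θ.rep e y ![Complex.I • dx i] : ℂ))

theorem Form.Smooth.differentiableAt_apply (hθ : θ.Smooth) (he : e ∈ coords n M)
    (hy : y ∈ e.target) (v : Fin 1 → Cn n) : DifferentiableAt ℝ (fun x => θ.rep e x v) y :=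
  (contDiffOn_apply (hθ e he) v).differentiableAt_of_isOpen e.open_target hy

theorem differentiableAt_realCoeff (hθ : θ.Smooth) (he : e ∈ coords n M)
    (hy : y ∈ e.target) (i : Fin n) : DifferentiableAt ℝ (realCoeff θ e i) y := by
  have h : ∀ v, DifferentiableAt ℝ (fun x => (θ.rep e x v : ℂ)) y := fun v =>
    Complex.ofRealCLM.differentiableAt.comp y (hθ.differentiableAt_apply he hy v)
  exact ((h _).fun_add ((h _).const_mul _)).const_mul _

theorem fderiv_apply_symm_of_closed (hθ : θ.Smooth) (he : e ∈ coords n M) (hy : y ∈ e.target)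
    (hd : extDeriv (θ.rep e) y = 0) (u v : Cn n) :
    fderiv ℝ (fun x => θ.rep e x ![v]) y u = fderiv ℝ (fun x => θ.rep e x ![u]) y v := by
  have h := extDeriv_apply ((hθ e he).differentiableAt_of_isOpen e.open_target hy) ![u, v]
  have h0 : (Fin.removeNth 0 ![u, v] : Fin 1 → Cn n) = ![v] := by
    ext i
    fin_cases i
    rfl
  have h1 : (Fin.removeNth 1 ![u, v] : Fin 1 → Cn n) = ![u] := by
    ext i
    fin_cases i
    rfl
  rw [hd, Fin.sum_univ_two, h0, h1] at h
  simp at h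
  linarith

/-- This is the vanishing of the (1,1)-part of dθ: for real θ the coefficient of dz̄ʲ is the
conjugate of that of dzʲ. -/
theorem wirtBar_realCoeff_conj (hθ : θ.Smooth) (he : e ∈ coords n M) (hy : y ∈ e.target)
    (hd : extDeriv (θ.rep e) y = 0) (i j : Fin n) :
    wirtBar j (realCoeff θ e i) y = conj (wirtBar i (realCoeff θ e j) y) := by
  have hs := fderiv_apply_symm_of_closed hθ he hy hd
  have h := fun i j => wirtBar_ofReal_add (hθ.differentiableAt_apply he hy ![dx i])
    (hθ.differentiableAt_apply he hy ![Complex.I • dx i]) j (-Complex.I)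
  change ∀ i j, wirtBar j (realCoeff θ e i) y = _ at h
  rw [h, h]
  simp only [map_mul, map_add, map_neg, map_div₀, map_one, map_ofNat, Complex.conj_I,
    Complex.conj_ofReal]
  rw [hs (dx j) (dx i), hs (Complex.I • dx j) (dx i), hs (dx j) (Complex.I • dx i),
    hs (Complex.I • dx j) (Complex.I • dx i)]
  ring

end RealOneForms

/-! ### From dω = θ ∧ ω to the torsion of the Chern connection. -/

namespace HermitianMetric

section LCK

set_option linter.unusedSectionVars false

variable {n : ℕ} {M : Type*} [TopologicalSpace M] [ChartedSpace (Cn n) M]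
  [IsManifold 𝓘(ℂ, Cn n) ω M] {e e' : OpenPartialHomeomorph M (Cn n)} {y : Cn n}
  (G : HermitianMetric n M)

theorem fund_rep (u v : Cn n) :
    G.fund.rep e y ![u, v] = (G.gRep e y (Complex.I • u) v : ℂ) := by
  change ((G.g (e.symm y) (Complex.I • cframe e y u) (frame e y v) : ℝ) : ℂ) = _
  rw [← map_smul]
  rfl

theorem contDiffOn_gRep (he : e ∈ coords n M) (u v : Cn n) :
    ContDiffOn ℝ ∞ (fun y => G.gRep e y u v) e.target := G.smooth e he u v

theorem differentiableAt_gRep (he : e ∈ coords n M) (hy : y ∈ e.target) (u v : Cn n) :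
    DifferentiableAt ℝ (fun y => G.gRep e y u v) y :=
  (G.contDiffOn_gRep he u v).differentiableAt_of_isOpen e.open_target hy

theorem contDiffOn_fund_rep (he : e ∈ coords n M) : ContDiffOn ℝ ∞ (G.fund.rep e) e.target := by
  refine contDiffOn_of_apply fun v => ?_
  have hv : v = ![v 0, v 1] := by
    ext i
    fin_cases i <;> rfl
  rw [hv]
  simp only [fund_rep]
  exact Complex.ofRealCLM.contDiff.comp_contDiffOn (G.contDiffOn_gRep he _ _)

theorem extDeriv_fund (he : e ∈ coords n M) (hy : y ∈ e.target) (u v w : Cn n) :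
    extDeriv (G.fund.rep e) y ![u, v, w] =
      ((fderiv ℝ (fun x => G.gRep e x (Complex.I • v) w) y u
        - fderiv ℝ (fun x => G.gRep e x (Complex.I • u) w) y v
        + fderiv ℝ (fun x => G.gRep e x (Complex.I • u) v) y w : ℝ) : ℂ) := by
  rw [extDeriv_apply ((G.contDiffOn_fund_rep he).differentiableAt_of_isOpen e.open_target hy)]
  have h0 : (Fin.removeNth 0 ![u, v, w] : Fin 2 → Cn n) = ![v, w] := by
    ext i
    fin_cases i <;> rfl
  have h1 : (Fin.removeNth 1 ![u, v, w] : Fin 2 → Cn n) = ![u, w] := by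
    ext i
    fin_cases i <;> rfl
  have h2 : (Fin.removeNth 2 ![u, v, w] : Fin 2 → Cn n) = ![u, v] := by
    ext i
    fin_cases i <;> rfl
  rw [Fin.sum_univ_three, h0, h1, h2]
  simp only [fund_rep, fderiv_ofReal_apply (G.differentiableAt_gRep he hy _ _)]
  simp [sub_eq_add_neg]

theorem fderiv_gRep_J_left (u v w : Cn n) :
    fderiv ℝ (fun x => G.gRep e x (Complex.I • u) v) y w =
      -fderiv ℝ (fun x => G.gRep e x u (Complex.I • v)) y w := by
  simp only [gRep_J_left]
  rw [fderiv_fun_neg]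
  rfl

/-- The complex form of `dω = θ ∧ ω`. -/
theorem wirt_h_sub_of_lck {θ : Form n M ℝ 1} (he : e ∈ coords n M) (hy : y ∈ e.target)
    (h : ∀ u v w : Cn n, extDeriv (G.fund.rep e) y ![u, v, w] =
      (θ.rep e y ![u] : ℂ) * G.fund.rep e y ![v, w]
        - (θ.rep e y ![v] : ℂ) * G.fund.rep e y ![u, w]
        + (θ.rep e y ![w] : ℂ) * G.fund.rep e y ![u, v]) (i j l : Fin n) :
    wirt i (fun x => G.h e x j l) y - wirt j (fun x => G.h e x i l) y =
      realCoeff θ e i y * G.h e y j l - realCoeff θ e j y * G.h e y i l := by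
  -- Δ u v w stands for (∂_u - θ(u)) g(v, w). It inherits the J-invariance of g in its last two
  -- arguments, and dω = θ ∧ ω becomes the homogeneous relation `hΔ`.
  let Δ : Cn n → Cn n → Cn n → ℝ := fun u v w =>
    fderiv ℝ (fun x => G.gRep e x v w) y u - θ.rep e y ![u] * G.gRep e y v w
  have hJ : ∀ u v w, Δ u (Complex.I • v) w = -Δ u v (Complex.I • w) := by
    intro u v w
    simp only [Δ]
    rw [fderiv_gRep_J_left, gRep_J_left]
    ring
  have hJJ : ∀ u v w, Δ u (Complex.I • v) (Complex.I • w) = Δ u v w := by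
    intro u v w
    simp only [Δ, gRep_map_J]
  have hΔ : ∀ u v w, Δ u (Complex.I • v) w - Δ v (Complex.I • u) w + Δ w (Complex.I • u) v = 0 := by
    intro u v w
    have h1 := h u v w
    rw [G.extDeriv_fund he hy] at h1
    simp only [fund_rep] at h1
    have h2 : fderiv ℝ (fun x => G.gRep e x (Complex.I • v) w) y u
        - fderiv ℝ (fun x => G.gRep e x (Complex.I • u) w) y v
        + fderiv ℝ (fun x => G.gRep e x (Complex.I • u) v) y w =
      θ.rep e y ![u] * G.gRep e y (Complex.I • v) w
        - θ.rep e y ![v] * G.gRep e y (Complex.I • u) w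
        + θ.rep e y ![w] * G.gRep e y (Complex.I • u) v := by exact_mod_cast h1
    simp only [Δ]
    linarith
  have hP : ∀ u v w, Δ u v w - Δ v u w + Δ (Complex.I • w) (Complex.I • u) v = 0 := by
    intro u v w
    have := hΔ u v (Complex.I • w)
    rwa [hJJ, hJJ] at this
  -- Adding `hP` at (Ju, v, w) and at (u, Jv, w) cancels the terms differentiated along Jw, since
  -- g(JJu, v) = -g(u, v) while g(Ju, Jv) = g(u, v).
  have hQ : ∀ u v w, Δ (Complex.I • u) v w - Δ (Complex.I • v) u w =
      Δ v (Complex.I • u) w - Δ u (Complex.I • v) w := by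
    intro u v w
    have h1 := hP (Complex.I • u) v w
    have h2 := hP u (Complex.I • v) w
    rw [hJJ] at h2
    have h3 : Δ (Complex.I • w) (Complex.I • u) (Complex.I • v) = Δ (Complex.I • w) u v :=
      hJJ _ _ _
    linarith [hJ (Complex.I • w) (Complex.I • u) v]
  have hw : ∀ i j l, wirt i (fun x => G.h e x j l) y - realCoeff θ e i y * G.h e y j l =
      (1 / 4) * (Δ (dx i) (dx j) (dx l) - Complex.I * Δ (Complex.I • dx i) (dx j) (dx l)
        + Complex.I * (Δ (dx i) (dx j) (Complex.I • dx l)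
          - Complex.I * Δ (Complex.I • dx i) (dx j) (Complex.I • dx l))) := by
    intro i j l
    simp only [h_apply, hForm]
    rw [wirt_ofReal_add (G.differentiableAt_gRep he hy _ _) (G.differentiableAt_gRep he hy _ _)]
    simp only [realCoeff, Δ]
    push_cast
    ring
  have h1 := hw i j l
  have h2 := hw j i l
  -- `h3` and `h4` are the imaginary and real parts of the claim, after antisymmetrizing `hw` in i
  -- and j.
  have h3 : ((Δ (Complex.I • dx i) (dx j) (dx l) - Δ (Complex.I • dx j) (dx i) (dx l) : ℝ) : ℂ) =
      ((Δ (dx i) (dx j) (Complex.I • dx l) - Δ (dx j) (dx i) (Complex.I • dx l) : ℝ) : ℂ) := by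
    rw [hQ, hJ, hJ]
    ring_nf
  have h4 : ((Δ (Complex.I • dx i) (dx j) (Complex.I • dx l) -
        Δ (Complex.I • dx j) (dx i) (Complex.I • dx l) : ℝ) : ℂ) =
      ((Δ (dx j) (dx i) (dx l) - Δ (dx i) (dx j) (dx l) : ℝ) : ℂ) := by
    rw [hQ, hJJ, hJJ]
  push_cast at h3 h4
  linear_combination h1 - h2 - (1 / 4) * Complex.I * h3 + (1 / 4) * h4 - (1 / 4) *
    (Δ (Complex.I • dx i) (dx j) (Complex.I • dx l) -
        Δ (Complex.I • dx j) (dx i) (Complex.I • dx l) : ℂ) * Complex.I_sq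

end LCK

end HermitianMetric

/-! ### The volume measure and its restriction to charts. -/

theorem measurableSet_inter_preimage {X Y : Type*} [TopologicalSpace X] [MeasurableSpace X]
    [BorelSpace X] [TopologicalSpace Y] [MeasurableSpace Y] [BorelSpace Y] {f : X → Y} {s : Set X}
    {A : Set Y} (hs : MeasurableSet s) (hf : ContinuousOn f s) (hA : MeasurableSet A) :
    MeasurableSet (s ∩ f ⁻¹' A) := by
  have h1 : MeasurableSet (s.domRestrict f ⁻¹' A) := hf.domRestrict.measurable hA
  have h2 := hs.subtype_image h1
  rwa [Set.domRestrict_eq, Set.preimage_comp, Subtype.image_preimage_coe] at h2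

theorem det_restrictScalars_eq {n : ℕ} (A : Cn n →L[ℂ] Cn n) :
    (A.restrictScalars ℝ).det = Complex.normSq (LinearMap.det (A : Cn n →ₗ[ℂ] Cn n)) := by
  rw [← Algebra.norm_complex_apply, ← LinearMap.det_restrictScalars]
  rfl

namespace HermitianMetric

section Volume

set_option linter.unusedSectionVars false

variable {n : ℕ} {M : Type*} [TopologicalSpace M] [ChartedSpace (Cn n) M]
  [IsManifold 𝓘(ℂ, Cn n) ω M] {e e' : OpenPartialHomeomorph M (Cn n)} {y : Cn n}
  (G : HermitianMetric n M)

theorem det_fderiv_trans : LinearMap.det (fderiv ℂ (trans e e') y : Cn n →ₗ[ℂ] Cn n) =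
    (jac e e' y).det := by
  rw [← LinearMap.det_toMatrix']
  congr 1

/-- The density of the volume measure in a chart. -/
def density (e : OpenPartialHomeomorph M (Cn n)) (y : Cn n) : ℝ := 2 ^ n * (G.h e y).det.re

theorem density_pos (he : e ∈ coords n M) (hy : y ∈ e.target) : 0 < G.density e y := by
  have := (Complex.lt_def.1 (G.det_h_pos he hy)).1
  exact mul_pos (by positivity) this

theorem det_h_eq_re (he : e ∈ coords n M) (hy : y ∈ e.target) :
    (G.h e y).det = ((G.h e y).det.re : ℂ) := by
  have := (Complex.lt_def.1 (G.det_h_pos he hy)).2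
  exact Complex.ext rfl (by simpa using this.symm)

theorem contDiffOn_density (he : e ∈ coords n M) :
    ContDiffOn ℝ ∞ (G.density e) e.target :=
  contDiffOn_const.mul (Complex.reCLM.contDiff.comp_contDiffOn
    (contDiffOn_det (G.contDiffOn_h he)))

/-- By `h_trans`, det h is multiplied by |det jac|², which is exactly the real Jacobian determinant
of the holomorphic coordinate change. -/
theorem density_trans (he : e ∈ coords n M) (he' : e' ∈ coords n M) (hy : y ∈ overlap e e') :
    G.density e y = |((fderiv ℂ (trans e e') y).restrictScalars ℝ).det| *
      G.density e' (trans e e' y) := by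
  rw [det_restrictScalars_eq, det_fderiv_trans, abs_of_nonneg (Complex.normSq_nonneg _), density,
    density, G.h_trans he he' hy, Matrix.det_mul, Matrix.det_mul, Matrix.det_transpose]
  have h3 : ((jac e e' y).map conj).det = conj (jac e e' y).det :=
    (RingHom.map_det (starRingEnd ℂ) _).symm
  rw [h3, mul_right_comm, Complex.mul_conj, Complex.re_ofReal_mul]
  ring

variable [MeasurableSpace M] [BorelSpace M]

theorem aemeasurable_symm (e : OpenPartialHomeomorph M (Cn n)) :
    AEMeasurable e.symm ((volume.restrict e.target).withDensity
      fun y => ENNReal.ofReal (2 ^ n * (G.h e y).det.re)) :=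
  (e.continuousOn_symm.aemeasurable e.open_target.measurableSet).mono_ac
    (withDensity_absolutelyContinuous _ _)

theorem chartVol_apply {A : Set M} (hA : MeasurableSet A) :
    G.chartVol e A = ∫⁻ y in e.target ∩ e.symm ⁻¹' A, ENNReal.ofReal (G.density e y) := by
  rw [chartVol, Measure.map_apply_of_aemeasurable (G.aemeasurable_symm e) hA, withDensity_apply',
    Measure.restrict_restrict' e.open_target.measurableSet, Set.inter_comm]
  rfl

theorem chartVol_inter_source {A : Set M} (hA : MeasurableSet A) :
    G.chartVol e (A ∩ e.source) = G.chartVol e A := by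
  rw [G.chartVol_apply hA, G.chartVol_apply (hA.inter e.open_source.measurableSet)]
  congr 2
  ext y
  simp only [Set.mem_inter_iff, Set.mem_preimage]
  exact ⟨fun h => ⟨h.1, h.2.1⟩, fun h => ⟨h.1, h.2, e.map_target h.1⟩⟩

theorem chartVol_eq_of_subset (he : e ∈ coords n M) (he' : e' ∈ coords n M) {A : Set M}
    (hA : MeasurableSet A) (h : A ⊆ e.source) (h' : A ⊆ e'.source) :
    G.chartVol e A = G.chartVol e' A := by
  rw [G.chartVol_apply hA, G.chartVol_apply hA]
  have hS : e.target ∩ e.symm ⁻¹' A ⊆ overlap e e' := fun y hy => ⟨hy.1, h' hy.2⟩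
  have himg : e'.target ∩ e'.symm ⁻¹' A = trans e e' '' (e.target ∩ e.symm ⁻¹' A) := by
    ext w
    constructor
    · rintro ⟨hw, hwA⟩
      have hw2 : w ∈ overlap e' e := ⟨hw, h hwA⟩
      refine ⟨trans e' e w, ⟨(trans_mem_overlap hw2).1, ?_⟩, trans_trans hw2⟩
      rwa [Set.mem_preimage, symm_trans hw2]
    · rintro ⟨y, hy, rfl⟩
      refine ⟨(trans_mem_overlap (hS hy)).1, ?_⟩
      rw [Set.mem_preimage, symm_trans (hS hy)]
      exact hy.2
  have hm : MeasurableSet (e.target ∩ e.symm ⁻¹' A) :=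
    measurableSet_inter_preimage e.open_target.measurableSet e.continuousOn_symm hA
  rw [himg, lintegral_image_eq_lintegral_abs_det_fderiv_mul volume hm
    (f' := fun y => (fderiv ℂ (trans e e') y).restrictScalars ℝ)]
  · refine setLIntegral_congr_fun hm fun y hy => ?_
    rw [G.density_trans he he' (hS hy), ENNReal.ofReal_mul (abs_nonneg _)]
  · exact fun y hy => ((differentiableAt_trans he he' (hS hy)).hasFDerivAt.restrictScalars
      ℝ).hasFDerivWithinAt
  · intro y hy z hz hyz
    rw [← trans_trans (hS hy), hyz, trans_trans (hS hz)]

theorem chartVol_le_vol (he : e ∈ coords n M) : G.chartVol e ≤ G.vol :=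
  le_iSup₂ (f := fun e (_ : e ∈ coords n M) => G.chartVol e) e he

/-- The supremum adds no mass on a chart domain, because all chart measures agree on overlaps. -/
theorem vol_restrict_source (he : e ∈ coords n M) : G.vol.restrict e.source = G.chartVol e := by
  have hU : MeasurableSet e.source := e.open_source.measurableSet
  -- It suffices to bound every chart measure by the right side. Inside the domain of e the other
  -- chart measure agrees with that of e on the overlap, and outside it is at most `vol`.
  have hle : G.vol ≤ G.chartVol e + G.vol.restrict e.sourceᶜ := by
    refine iSup₂_le fun e' he' => Measure.le_iff.2 fun A hA => ?_
    rw [← measure_inter_add_sdiff A hU, Measure.add_apply, Measure.restrict_apply hA]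
    refine add_le_add ?_ (chartVol_le_vol G he' _)
    rw [← G.chartVol_inter_source (hA.inter hU), ← G.chartVol_eq_of_subset he he'
      ((hA.inter hU).inter e'.open_source.measurableSet)
      (fun p hp => hp.1.2) (fun p hp => hp.2)]
    exact measure_mono fun p hp => hp.1.1
  refine le_antisymm (Measure.le_iff.2 fun A hA => ?_) (Measure.le_iff.2 fun A hA => ?_)
  · rw [Measure.restrict_apply hA]
    refine (hle _).trans ?_
    rw [Measure.add_apply, Measure.restrict_apply (hA.inter hU), Set.inter_assoc,
      Set.inter_compl_self, Set.inter_empty, measure_empty, add_zero]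
    exact measure_mono Set.inter_subset_left
  · rw [Measure.restrict_apply hA, ← G.chartVol_inter_source hA]
    exact chartVol_le_vol G he _

theorem aemeasurable_density (he : e ∈ coords n M) :
    AEMeasurable (G.density e) (volume.restrict e.target) :=
  (G.contDiffOn_density he).continuousOn.aemeasurable e.open_target.measurableSet

theorem setIntegral_vol_source {f : M → ℂ} (he : e ∈ coords n M)
    (hf : AEStronglyMeasurable f (G.vol.restrict e.source)) :
    ∫ p in e.source, f p ∂G.vol = ∫ y in e.target, G.density e y • f (e.symm y) := by
  rw [G.vol_restrict_source he] at hf ⊢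
  have h1 : ∫ p, f p ∂G.chartVol e = _ := integral_map (G.aemeasurable_symm e) hf
  have h2 := integral_withDensity_eq_integral_toReal_smul₀
    (f := fun y => ENNReal.ofReal (G.density e y)) (G.aemeasurable_density he).ennreal_ofReal
    (Filter.Eventually.of_forall fun _ => ENNReal.ofReal_lt_top) fun y => f (e.symm y)
  refine (h1.trans h2).trans ?_
  refine setIntegral_congr_fun e.open_target.measurableSet fun y hy => ?_
  simp only [ENNReal.toReal_ofReal (G.density_pos he hy).le]

theorem vol_isOpenPosMeasure : G.vol.IsOpenPosMeasure := by
  refine ⟨fun U hU ⟨p, hp⟩ => ?_⟩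
  set e := chartAt (Cn n) p
  have he : e ∈ coords n M := chartAt_mem_coords p
  have hS : IsOpen (e.target ∩ e.symm ⁻¹' U) := e.symm.isOpen_inter_preimage hU
  have hne : (e.target ∩ e.symm ⁻¹' U).Nonempty :=
    ⟨e p, e.map_source (mem_chart_source _ p), by
      rwa [Set.mem_preimage, e.left_inv (mem_chart_source _ p)]⟩
  refine ne_of_gt (lt_of_lt_of_le ?_ (chartVol_le_vol G he U))
  rw [G.chartVol_apply hU.measurableSet, pos_iff_ne_zero]
  intro h0
  rw [lintegral_eq_zero_iff' ((G.aemeasurable_density he).mono_set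
    Set.inter_subset_left).ennreal_ofReal] at h0
  have h1 := (ae_restrict_iff' hS.measurableSet).1 h0
  refine (hS.measure_pos volume hne).ne' (measure_eq_zero_iff_ae_notMem.2 ?_)
  filter_upwards [h1] with y hy hyS
  have h2 : ENNReal.ofReal (G.density e y) = 0 := hy hyS
  rw [ENNReal.ofReal_eq_zero] at h2
  exact absurd (G.density_pos he hyS.1) h2.not_gt

theorem vol_isLocallyFiniteMeasure : IsLocallyFiniteMeasure G.vol := by
  refine ⟨fun p => ?_⟩
  set e := chartAt (Cn n) p
  have he : e ∈ coords n M := chartAt_mem_coords p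
  have hp : e p ∈ e.target := mem_chart_target _ p
  obtain ⟨K, hK, hKt, hKc⟩ := local_compact_nhds (e.open_target.mem_nhds hp)
  refine ⟨e.source ∩ e ⁻¹' interior K, ?_, ?_⟩
  · exact (e.isOpen_inter_preimage isOpen_interior).mem_nhds
      ⟨mem_chart_source _ p, mem_interior_iff_mem_nhds.2 hK⟩
  · have hm : MeasurableSet (e.source ∩ e ⁻¹' interior K) :=
      (e.isOpen_inter_preimage isOpen_interior).measurableSet
    have h1 : G.vol (e.source ∩ e ⁻¹' interior K) = G.chartVol e (e.source ∩ e ⁻¹' interior K) := by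
      rw [← G.vol_restrict_source he, Measure.restrict_apply hm, Set.inter_eq_left.2
        Set.inter_subset_left]
    rw [h1, G.chartVol_apply hm]
    have h2 : e.target ∩ e.symm ⁻¹' (e.source ∩ e ⁻¹' interior K) ⊆ K := by
      rintro y ⟨hy, -, hyK⟩
      rw [Set.mem_preimage, e.right_inv hy] at hyK
      exact interior_subset hyK
    refine (lintegral_mono_set h2).trans_lt ?_
    have h3 : IntegrableOn (G.density e) K :=
      ((G.contDiffOn_density he).continuousOn.mono hKt).integrableOn_compact hKc
    exact h3.lintegral_lt_top

end Volume

end HermitianMetric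

/-! ### Compactly supported divergences integrate to zero. -/

section LocalIntegration

variable {n : ℕ}

/-- Integration by parts against the constant function 1. -/
theorem integral_fderiv_eq_zero {W : Cn n → ℂ} (hW : ContDiff ℝ 1 W) (hc : HasCompactSupport W)
    (v : Cn n) : ∫ y, fderiv ℝ W y v = 0 := by
  have h1 : Continuous fun y => fderiv ℝ W y v :=
    (hW.continuous_fderiv (by simp)).clm_apply continuous_const
  have h2 : HasCompactSupport fun y => fderiv ℝ W y v := hc.fderiv_apply ℝ v
  have h := integral_mul_fderiv_eq_neg_fderiv_mul_of_integrable (μ := volume)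
    (f := fun _ : Cn n => (1 : ℂ)) (g := W) (v := v) (by simp)
    (by simpa using h1.integrable_of_hasCompactSupport h2)
    (by simpa using hW.continuous.integrable_of_hasCompactSupport hc)
    (fun x _ => differentiableAt_const _) (fun x _ => hW.differentiable (by simp) x)
  simpa using h

theorem setIntegral_wirt_eq_zero {V : Cn n → ℂ} {U K : Set (Cn n)} (hU : IsOpen U)
    (hV : ContDiffOn ℝ ∞ V U) (hK : IsCompact K) (hKU : K ⊆ U) (h0 : ∀ y ∈ U, y ∉ K → V y = 0)
    (i : Fin n) : ∫ y in U, wirt i V y = 0 := by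
  -- Extension by zero stays C¹ on all of ℂⁿ, since V already vanishes on U outside the compact set
  -- K.
  set W := U.indicator V with hW
  have h1 : ∀ y, y ∉ K → W y = 0 := by
    intro y hy
    by_cases hyU : y ∈ U
    · rw [hW, Set.indicator_of_mem hyU, h0 y hyU hy]
    · rw [hW, Set.indicator_of_notMem hyU]
  have h2 : ∀ y ∉ K, W =ᶠ[nhds y] fun _ => 0 := fun y hy =>
    Filter.eventually_of_mem (hK.isClosed.isOpen_compl.mem_nhds hy) h1
  have h3 : ∀ y ∈ U, W =ᶠ[nhds y] V := fun y hy =>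
    Filter.eventually_of_mem (hU.mem_nhds hy) fun x hx => Set.indicator_of_mem hx V
  have hWs : ContDiff ℝ 1 W := by
    rw [contDiff_iff_contDiffAt]
    intro y
    by_cases hy : y ∈ K
    · exact (((hV.of_le (by simp)).contDiffAt (hU.mem_nhds (hKU hy)))).congr_of_eventuallyEq
        (h3 y (hKU hy))
    · exact contDiffAt_const.congr_of_eventuallyEq (h2 y hy)
  have hWc : HasCompactSupport W := HasCompactSupport.intro hK h1
  have h4 : ∫ y in U, wirt i V y = ∫ y in U, wirt i W y :=
    setIntegral_congr_fun hU.measurableSet fun y hy => (wirt_congr i (h3 y hy)).symm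
  have h5 : ∫ y in U, wirt i W y = ∫ y, wirt i W y := by
    refine setIntegral_eq_integral_of_forall_compl_eq_zero fun y hy => ?_
    rw [wirt_congr i (h2 y fun h => hy (hKU h)), wirt_const]
  have hint : ∀ v : Cn n, Integrable fun y => fderiv ℝ W y v := fun v =>
    ((hWs.continuous_fderiv (by simp)).clm_apply
      continuous_const).integrable_of_hasCompactSupport (hWc.fderiv_apply ℝ v)
  rw [h4, h5]
  simp only [wirt]
  rw [integral_const_mul, integral_sub (hint _) ((hint _).const_mul _), integral_const_mul,
    integral_fderiv_eq_zero hWs hWc, integral_fderiv_eq_zero hWs hWc]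
  simp

end LocalIntegration

/-! ### The underlying real manifold and a partition of unity. -/

section RealStructure

set_option linter.unusedSectionVars false

variable {n : ℕ} {M : Type*} [TopologicalSpace M] [ChartedSpace (Cn n) M]
  [IsManifold 𝓘(ℂ, Cn n) ω M] {e e' : OpenPartialHomeomorph M (Cn n)} {y : Cn n}

theorem contDiffOn_real_trans (he : e ∈ coords n M) (he' : e' ∈ coords n M) :
    ContDiffOn ℝ ∞ (trans e e') (overlap e e') :=
  ((contDiffOn_trans he he').restrict_scalars ℝ).of_le (by simp)

theorem isManifold_real (n : ℕ) (M : Type*) [TopologicalSpace M] [ChartedSpace (Cn n) M]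
    [IsManifold 𝓘(ℂ, Cn n) ω M] : IsManifold 𝓘(ℝ, Cn n) ∞ M := by
  refine isManifold_of_contDiffOn _ _ _ fun e e' he he' => ?_
  have h := contDiffOn_real_trans (n := n) (M := M)
    (IsManifold.subset_maximalAtlas (I := 𝓘(ℂ, Cn n)) (n := ω) he)
    (IsManifold.subset_maximalAtlas (I := 𝓘(ℂ, Cn n)) (n := ω) he')
  simpa [Function.comp_def, overlap, funext_iff, trans] using! h

/-- A smooth partition of unity subordinate to finitely many charts. -/
theorem exists_partition [T2Space M] [CompactSpace M] :
    ∃ (t : Finset M) (ρ : t → M → ℝ), (∀ p, ∑ i, ρ i p = 1) ∧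
      (∀ i, tsupport (ρ i) ⊆ (chartAt (Cn n) (i : M)).source) ∧
      ∀ i, ∀ e ∈ coords n M, ContDiffOn ℝ ∞ (fun y => ρ i (e.symm y)) e.target := by
  have := isManifold_real n M
  obtain ⟨t, ht⟩ := isCompact_univ.elim_nhds_subcover
    (fun p : M => (chartAt (Cn n) p).source)
    fun p _ => (chartAt (Cn n) p).open_source.mem_nhds (mem_chart_source _ p)
  obtain ⟨f, hf⟩ := SmoothPartitionOfUnity.exists_isSubordinate 𝓘(ℝ, Cn n) (s := Set.univ)
    isClosed_univ (fun i : t => (chartAt (Cn n) (i : M)).source)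
    (fun i => (chartAt (Cn n) (i : M)).open_source) (by
      intro p hp
      obtain ⟨i, hi, hpi⟩ := Set.mem_iUnion₂.1 (ht.2 hp)
      exact Set.mem_iUnion.2 ⟨⟨i, hi⟩, hpi⟩)
  refine ⟨t, fun i => f i, fun p => ?_, fun i => hf i, fun i e he => ?_⟩
  · rw [← finsum_eq_sum_of_fintype]
    exact f.sum_eq_one (Set.mem_univ p)
  · intro y hy
    set c := chartAt (Cn n) (e.symm y)
    have hc : c ∈ coords n M := chartAt_mem_coords _
    have hyo : y ∈ overlap e c := mem_overlap_chartAt hy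
    have h1 : ContMDiffOn 𝓘(ℝ, Cn n) 𝓘(ℝ, ℝ) ∞ (fun x => f i (c.symm x)) c.target :=
      (f i).contMDiff.comp_contMDiffOn contMDiffOn_chart_symm
    have h2 := contMDiffOn_iff_contDiffOn.1 h1
    have h3 : ContDiffAt ℝ ∞ (fun x => f i (c.symm (trans e c x))) y :=
      (h2.contDiffAt (c.open_target.mem_nhds (trans_mem_overlap hyo).1)).comp y
        ((contDiffOn_real_trans he hc).contDiffAt (overlap_mem_nhds hyo))
    refine (h3.congr_of_eventuallyEq ?_).contDiffWithinAt
    filter_upwards [overlap_mem_nhds hyo] with x hx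
    rw [symm_trans hx]

end RealStructure

/-! ### Functions on M given by coordinate-independent expressions. -/

section Globalize

set_option linter.unusedSectionVars false

variable {n : ℕ} {M : Type*} [TopologicalSpace M] [ChartedSpace (Cn n) M]
  [IsManifold 𝓘(ℂ, Cn n) ω M] {e e' : OpenPartialHomeomorph M (Cn n)} {y : Cn n}

/-- The function on `M` that is given by a coordinate expression. -/
def globalize (F : OpenPartialHomeomorph M (Cn n) → Cn n → ℂ) (p : M) : ℂ :=
  F (chartAt (Cn n) p) (chartAt (Cn n) p p)

/-- A continuous coordinate expression that does not depend on the coordinates. -/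
structure IsInvariant (F : OpenPartialHomeomorph M (Cn n) → Cn n → ℂ) : Prop where
  continuousOn : ∀ e ∈ coords n M, ContinuousOn (F e) e.target
  trans : ∀ e ∈ coords n M, ∀ e' ∈ coords n M, ∀ y ∈ overlap e e', F e y = F e' (trans e e' y)

variable {F : OpenPartialHomeomorph M (Cn n) → Cn n → ℂ}

theorem IsInvariant.globalize_symm (hF : IsInvariant F) (he : e ∈ coords n M)
    (hy : y ∈ e.target) : globalize F (e.symm y) = F e y :=
  (hF.trans e he _ (chartAt_mem_coords _) y (mem_overlap_chartAt hy)).symm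

theorem IsInvariant.globalize_eq (hF : IsInvariant F) (he : e ∈ coords n M) {p : M}
    (hp : p ∈ e.source) : globalize F p = F e (e p) := by
  rw [← hF.globalize_symm he (e.map_source hp), e.left_inv hp]

theorem IsInvariant.continuous (hF : IsInvariant F) : Continuous (globalize F) := by
  rw [continuous_iff_continuousAt]
  intro p
  set e := chartAt (Cn n) p
  have he : e ∈ coords n M := chartAt_mem_coords p
  have hp : p ∈ e.source := mem_chart_source _ p
  have h1 : ContinuousAt (fun q => F e (e q)) p :=
    ((hF.continuousOn e he).continuousAt (e.open_target.mem_nhds (e.map_source hp))).comp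
      (e.continuousAt hp)
  refine h1.congr ?_
  filter_upwards [e.open_source.mem_nhds hp] with q hq
  exact (hF.globalize_eq he hq).symm

end Globalize

/-! ### Products with functions, differences and equality of (0,1)-forms. -/

section FormOperations

set_option linter.unusedSectionVars false

variable {n : ℕ} {M : Type*} [TopologicalSpace M] [ChartedSpace (Cn n) M]
  {e : OpenPartialHomeomorph M (Cn n)} {y : Cn n}

/-- The product of a function and a form. -/
def Form.mulFun (ρ : M → ℝ) (φ : Form n M ℂ 1) : Form n M ℂ 1 := fun p => ρ p • φ p

theorem Form.mulFun_rep (ρ : M → ℝ) (φ : Form n M ℂ 1) (v : Fin 1 → Cn n) :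
    (φ.mulFun ρ).rep e y v = ρ (e.symm y) * φ.rep e y v := by
  change ρ (e.symm y) • φ.rep e y v = _
  rw [Complex.real_smul]

theorem Form.mulFun_coeffBar (ρ : M → ℝ) (φ : Form n M ℂ 1) (j : Fin n) :
    (φ.mulFun ρ).coeffBar e y j = ρ (e.symm y) * φ.coeffBar e y j := by
  simp only [Form.coeffBar, mulFun_rep]
  ring

theorem Form.IsSmooth01.mulFun {ρ : M → ℝ} {φ : Form n M ℂ 1} (hφ : φ.IsSmooth01)
    (hρ : ∀ e ∈ coords n M, ContDiffOn ℝ ∞ (fun y => ρ (e.symm y)) e.target) :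
    (φ.mulFun ρ).IsSmooth01 := by
  refine ⟨fun e he => contDiffOn_of_apply fun v => ?_, fun p v => ?_⟩
  · simp only [Form.mulFun_rep]
    exact (Complex.ofRealCLM.contDiff.comp_contDiffOn (hρ e he)).mul
      (contDiffOn_apply (hφ.1 e he) v)
  · change ρ p • φ p ![Complex.I • v] = -(Complex.I * ρ p • φ p ![v])
    rw [hφ.2, Complex.real_smul, Complex.real_smul]
    ring

/-- The difference of two forms. -/
def Form.subForm (φ ψ : Form n M ℂ 1) : Form n M ℂ 1 := fun p => φ p - ψ p

theorem Form.subForm_rep (φ ψ : Form n M ℂ 1) (v : Fin 1 → Cn n) :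
    (φ.subForm ψ).rep e y v = φ.rep e y v - ψ.rep e y v := rfl

theorem Form.subForm_coeffBar (φ ψ : Form n M ℂ 1) (j : Fin n) :
    (φ.subForm ψ).coeffBar e y j = φ.coeffBar e y j - ψ.coeffBar e y j := by
  simp only [Form.coeffBar, subForm_rep]
  ring

theorem Form.IsSmooth01.subForm {φ ψ : Form n M ℂ 1} (hφ : φ.IsSmooth01) (hψ : ψ.IsSmooth01) :
    (φ.subForm ψ).IsSmooth01 := by
  refine ⟨fun e he => contDiffOn_of_apply fun v => ?_, fun p v => ?_⟩
  · simp only [Form.subForm_rep]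
    exact (contDiffOn_apply (hφ.1 e he) v).sub (contDiffOn_apply (hψ.1 e he) v)
  · change φ p ![Complex.I • v] - ψ p ![Complex.I • v] = -(Complex.I * (φ p ![v] - ψ p ![v]))
    rw [hφ.2, hψ.2]
    ring

/-- A `(0,1)`-form vanishes if its coefficients do. -/
theorem Form.IsSmooth01.eq_of_coeffBar [IsManifold 𝓘(ℂ, Cn n) ω M] {φ ψ : Form n M ℂ 1}
    (hφ : φ.IsSmooth01) (hψ : ψ.IsSmooth01)
    (h : ∀ p j, φ.coeffBar (chartAt (Cn n) p) (chartAt (Cn n) p p) j =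
      ψ.coeffBar (chartAt (Cn n) p) (chartAt (Cn n) p p) j) : φ = ψ := by
  have hrep : ∀ (χ : Form n M ℂ 1) (p : M) (v : Fin 1 → Cn n),
      χ.rep (chartAt (Cn n) p) (chartAt (Cn n) p p) v = (χ p : Cn n [⋀^Fin 1]→L[ℝ] ℂ) v := by
    intro χ p v
    let A : M → (Cn n [⋀^Fin 1]→L[ℝ] ℂ) := χ
    change A ((chartAt (Cn n) p).symm (chartAt (Cn n) p p))
      (fun i => cframe (chartAt (Cn n) p) (chartAt (Cn n) p p) (v i)) = A p v
    rw [cframe_chartAt, (chartAt (Cn n) p).left_inv (mem_chart_source _ p)]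
    rfl
  funext p
  have h1 : ∀ v : Fin 1 → Cn n, (φ p : Cn n [⋀^Fin 1]→L[ℝ] ℂ) v =
      (ψ p : Cn n [⋀^Fin 1]→L[ℝ] ℂ) v := by
    intro v
    have hv : v = ![v 0] := by
      ext i
      fin_cases i
      rfl
    rw [← hrep, ← hrep, hv, hφ.rep_eq, hψ.rep_eq]
    simp only [h]
  exact ContinuousAlternatingMap.ext h1

end FormOperations

/-! ### The adjointness relation for ∂*ω. -/

namespace HermitianMetric

section Pairing

set_option linter.unusedSectionVars false

variable {n : ℕ} {M : Type*} [TopologicalSpace M] [ChartedSpace (Cn n) M]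
  [IsManifold 𝓘(ℂ, Cn n) ω M] {e e' : OpenPartialHomeomorph M (Cn n)} {y : Cn n}
  (G : HermitianMetric n M) {φ ψ : Form n M ℂ 1}

theorem inner01_eq_tr (a b : Fin n → ℂ) :
    G.inner01 e y a b = G.tr e y (fun k l => a l * conj (b k)) := by
  simp only [inner01, tr, mul_assoc]

/-- The coefficients of ω are √-1 h, so one inverse metric cancels against h and the other takes a
trace; conjugation makes the factor -√-1. -/
theorem inner11_fund (he : e ∈ coords n M) (hy : y ∈ e.target) (A : Fin n → Fin n → ℂ) :
    G.inner11 e y A (G.fund.coeff11 e y) = -Complex.I * G.tr e y A := by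
  have h1 : ∀ i j k l, G.hInv e y i j * G.hInv e y k l * A i l *
      conj (G.fund.coeff11 e y j k) =
      (-Complex.I * G.hInv e y k l * A i l) * (G.hInv e y i j * G.h e y k j) := by
    intro i j k l
    rw [fund_coeff11, map_mul, h_conj, Complex.conj_I]
    ring
  simp only [inner11, h1]
  rw [tr, Finset.mul_sum]
  refine Finset.sum_congr rfl fun i _ => ?_
  rw [Finset.sum_comm]
  have h2 : ∀ k, ∑ j, ∑ l, (-Complex.I * G.hInv e y k l * A i l) *
      (G.hInv e y i j * G.h e y k j) =
      if i = k then ∑ l, -Complex.I * G.hInv e y k l * A i l else 0 := by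
    intro k
    rw [Finset.sum_comm]
    simp only [← Finset.mul_sum, G.sum_hInv_mul_h he hy]
    split_ifs <;> simp
  simp only [h2, Finset.sum_ite_eq, Finset.mem_univ, if_true]
  simp only [Finset.mul_sum, mul_assoc]

theorem inner01_trans (hφ : φ.IsSmooth01) (hψ : ψ.IsSmooth01) (he : e ∈ coords n M)
    (he' : e' ∈ coords n M) (hy : y ∈ overlap e e') :
    G.inner01 e y (φ.coeffBar e y) (ψ.coeffBar e y) =
      G.inner01 e' (trans e e' y) (φ.coeffBar e' (trans e e' y))
        (ψ.coeffBar e' (trans e e' y)) := by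
  rw [inner01_eq_tr, inner01_eq_tr]
  have h := G.tr_trans he he' hy (Matrix.of fun k l =>
    φ.coeffBar e' (trans e e' y) l * conj (ψ.coeffBar e' (trans e e' y) k))
  refine Eq.trans (congrArg _ (funext₂ fun k l => ?_)) h
  rw [hφ.coeffBar_trans he he' hy, hψ.coeffBar_trans he he' hy]
  simp only [Matrix.mul_apply, Matrix.transpose_apply, Matrix.map_apply, Matrix.of_apply,
    map_sum, map_mul, Complex.conj_conj, Finset.sum_mul, Finset.mul_sum]
  rw [Finset.sum_comm]
  exact Finset.sum_congr rfl fun m _ => Finset.sum_congr rfl fun c _ => by ring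

theorem contDiffOn_tr (he : e ∈ coords n M) {X : Cn n → Fin n → Fin n → ℂ}
    (hX : ∀ k l, ContDiffOn ℝ ∞ (fun y => X y k l) e.target) :
    ContDiffOn ℝ ∞ (fun y => G.tr e y (X y)) e.target :=
  ContDiffOn.sum fun _ _ => ContDiffOn.sum fun _ _ => (G.contDiffOn_hInv he _ _).mul (hX _ _)

theorem isInvariant_inner01 (hφ : φ.IsSmooth01) (hψ : ψ.IsSmooth01) :
    IsInvariant (n := n) (M := M)
      fun e y => G.inner01 e y (φ.coeffBar e y) (ψ.coeffBar e y) where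
  continuousOn e he := by
    simp only [inner01_eq_tr]
    exact (G.contDiffOn_tr he fun k l => (hφ.contDiffOn_coeffBar he l).mul
      (contDiffOn_conj (hψ.contDiffOn_coeffBar he k))).continuousOn
  trans _ he _ he' _ hy := G.inner01_trans hφ hψ he he' hy

theorem isInvariant_inner11 (hφ : φ.IsSmooth01) :
    IsInvariant (n := n) (M := M)
      fun e y => G.inner11 e y (φ.del e y) (G.fund.coeff11 e y) where
  continuousOn e he := by
    have h1 : ContDiffOn ℝ ∞ (fun y => -Complex.I * G.tr e y (φ.del e y)) e.target :=
      contDiffOn_const.mul (G.contDiffOn_tr he fun k l =>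
        contDiffOn_wirt e.open_target (hφ.contDiffOn_coeffBar he l) k)
    exact h1.continuousOn.congr fun y hy => G.inner11_fund he hy _
  trans e he e' he' y hy := by
    rw [G.inner11_fund he hy.1, G.inner11_fund he' (trans_mem_overlap hy).1,
      hφ.del_trans he he' hy, G.tr_trans he he' hy]
    rfl

/-- The integrand of `(∂φ, ω) - (φ, -√-1 τ̄)`. -/
def defect (φ : Form n M ℂ 1) (e : OpenPartialHomeomorph M (Cn n)) (y : Cn n) : ℂ :=
  G.inner11 e y (φ.del e y) (G.fund.coeff11 e y) -
    G.inner01 e y (φ.coeffBar e y) (G.torsionForm.coeffBar e y)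

theorem isInvariant_defect (hφ : φ.IsSmooth01) : IsInvariant (G.defect φ) where
  continuousOn e he := ((G.isInvariant_inner11 hφ).continuousOn e he).sub
    ((G.isInvariant_inner01 hφ G.torsionForm_isSmooth01).continuousOn e he)
  trans e he e' he' y hy := congrArg₂ HSub.hSub ((G.isInvariant_inner11 hφ).trans e he e' he' y hy)
    ((G.isInvariant_inner01 hφ G.torsionForm_isSmooth01).trans e he e' he' y hy)

theorem defect_eq (he : e ∈ coords n M) (hy : y ∈ e.target) :
    G.defect φ e y = -Complex.I * (G.tr e y (φ.del e y) +
      ∑ l, φ.coeffBar e y l * ∑ k, G.hInv e y k l * G.torsionTrace e y k) := by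
  have h1 : G.inner01 e y (φ.coeffBar e y) (G.torsionForm.coeffBar e y) =
      Complex.I * ∑ l, φ.coeffBar e y l * ∑ k, G.hInv e y k l * G.torsionTrace e y k := by
    rw [inner01, Finset.sum_comm]
    simp only [Finset.mul_sum, G.torsionForm_coeffBar he hy]
    refine Finset.sum_congr rfl fun l _ => Finset.sum_congr rfl fun k _ => ?_
    simp only [map_mul, map_neg, Complex.conj_I, Complex.conj_conj]
    ring
  rw [defect, G.inner11_fund he hy, h1]
  ring

/-- In a chart, the integrand is a divergence. -/
theorem density_smul_defect (hφ : φ.IsSmooth01) (he : e ∈ coords n M) (hy : y ∈ e.target) :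
    G.density e y • G.defect φ e y = ∑ i, wirt i (fun x => ∑ l, (-Complex.I * 2 ^ n) *
      ((G.hInv e x i l * (G.h e x).det) * φ.coeffBar e x l)) y := by
  have hdet : DifferentiableAt ℝ (fun x => (G.h e x).det) y :=
    (contDiffOn_det (G.contDiffOn_h he)).differentiableAt_of_isOpen e.open_target hy
  have hd : ∀ i l, DifferentiableAt ℝ (fun x => G.hInv e x i l * (G.h e x).det) y := fun i l =>
    (G.differentiableAt_hInv he hy i l).fun_mul hdet
  have hφd := hφ.differentiableAt_coeffBar he hy
  have h1 : ∀ i, wirt i (fun x => ∑ l, (-Complex.I * 2 ^ n) *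
      ((G.hInv e x i l * (G.h e x).det) * φ.coeffBar e x l)) y =
      ∑ l, (-Complex.I * 2 ^ n) * (G.hInv e y i l * (G.h e y).det * φ.del e y i l +
        wirt i (fun x => G.hInv e x i l * (G.h e x).det) y * φ.coeffBar e y l) := by
    intro i
    rw [wirt_sum _ _ fun l _ => ((hd i l).fun_mul (hφd l)).const_mul _]
    refine Finset.sum_congr rfl fun l _ => ?_
    rw [wirt_const_mul i _ ((hd i l).fun_mul (hφd l)), wirt_mul i (hd i l) (hφd l)]
    rfl
  have h2 : ∑ i, ∑ l, wirt i (fun x => G.hInv e x i l * (G.h e x).det) y * φ.coeffBar e y l =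
      (G.h e y).det *
        ∑ l, φ.coeffBar e y l * ∑ k, G.hInv e y k l * G.torsionTrace e y k := by
    rw [Finset.sum_comm, Finset.mul_sum]
    refine Finset.sum_congr rfl fun l _ => ?_
    rw [← Finset.sum_mul, G.sum_wirt_hInv_mul_det he hy]
    ring
  have h3 : ∑ i, ∑ l, G.hInv e y i l * (G.h e y).det * φ.del e y i l =
      (G.h e y).det * G.tr e y (φ.del e y) := by
    simp only [tr, Finset.mul_sum]
    exact Finset.sum_congr rfl fun i _ => Finset.sum_congr rfl fun l _ => by ring
  simp only [h1]
  simp only [← Finset.mul_sum, Finset.sum_add_distrib]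
  rw [h2, h3, G.defect_eq he hy, density, G.det_h_eq_re he hy, Complex.real_smul]
  push_cast
  simp only [Complex.ofReal_re]
  ring

variable [MeasurableSpace M] [BorelSpace M]

/-- The integral can be computed in the one chart that contains the support, where the integrand
times the density is a divergence. -/
theorem integral_defect_of_support [T2Space M] [CompactSpace M] (hφ : φ.IsSmooth01)
    (he : e ∈ coords n M) {K : Set M} (hK : IsClosed K) (hKe : K ⊆ e.source)
    (h0 : ∀ p ∉ K, φ p = 0) : ∫ p, globalize (G.defect φ) p ∂G.vol = 0 := by
  have hc0 : ∀ (c : OpenPartialHomeomorph M (Cn n)) (x : Cn n), c.symm x ∉ K →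
      φ.coeffBar c x = 0 := by
    intro c x hx
    have h1 : ∀ v, φ.rep c x v = 0 := by
      intro v
      change φ (c.symm x) _ = 0
      rw [h0 _ hx]
      rfl
    ext j
    simp [Form.coeffBar, h1]
  have hinv := G.isInvariant_defect hφ
  have hzero : ∀ p ∉ K, globalize (G.defect φ) p = 0 := by
    intro p hp
    set c := chartAt (Cn n) p
    have hc : c ∈ coords n M := chartAt_mem_coords p
    have hpc : p ∈ c.source := mem_chart_source _ p
    have hev : ∀ᶠ x in nhds (c p), φ.coeffBar c x = 0 := by
      have hcont := (c.continuousAt_symm (c.map_source hpc))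
      rw [ContinuousAt, c.left_inv hpc] at hcont
      filter_upwards [hcont (hK.isOpen_compl.mem_nhds hp)] with x hx
      exact hc0 c x hx
    have h1 : φ.coeffBar c (c p) = 0 := hev.self_of_nhds
    have h2 : φ.del c (c p) = 0 := by
      ext i j
      have h3 : (fun x => φ.coeffBar c x j) =ᶠ[nhds (c p)] fun _ => 0 := by
        filter_upwards [hev] with x hx
        simp [hx]
      simp [Form.del, wirt_congr i h3]
    change G.defect φ c (c p) = 0
    rw [G.defect_eq hc (c.map_source hpc), h1, h2]
    simp [tr]
  have h1 : ∫ p, globalize (G.defect φ) p ∂G.vol =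
      ∫ p in e.source, globalize (G.defect φ) p ∂G.vol :=
    (setIntegral_eq_integral_of_forall_compl_eq_zero fun p hp =>
      hzero p fun h => hp (hKe h)).symm
  rw [h1, G.setIntegral_vol_source he hinv.continuous.aestronglyMeasurable]
  have h2 : ∫ y in e.target, G.density e y • globalize (G.defect φ) (e.symm y) =
      ∫ y in e.target, ∑ i, wirt i (fun x => ∑ l, (-Complex.I * 2 ^ n) *
        ((G.hInv e x i l * (G.h e x).det) * φ.coeffBar e x l)) y := by
    refine setIntegral_congr_fun e.open_target.measurableSet fun y hy => ?_
    simp only [hinv.globalize_symm he hy, G.density_smul_defect hφ he hy]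
  have hKc : IsCompact (e '' K) := hK.isCompact.image_of_continuousOn
    (e.continuousOn.mono hKe)
  have hKt : e '' K ⊆ e.target := by
    rintro _ ⟨p, hp, rfl⟩
    exact e.map_source (hKe hp)
  have hV : ∀ i, ContDiffOn ℝ ∞ (fun x => ∑ l, (-Complex.I * 2 ^ n) *
      ((G.hInv e x i l * (G.h e x).det) * φ.coeffBar e x l)) e.target := fun i =>
    ContDiffOn.sum fun l _ => contDiffOn_const.mul (((G.contDiffOn_hInv he i l).mul
      (contDiffOn_det (G.contDiffOn_h he))).mul (hφ.contDiffOn_coeffBar he l))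
  have hV0 : ∀ i, ∀ y ∈ e.target, y ∉ e '' K → ∑ l, (-Complex.I * 2 ^ n) *
      ((G.hInv e y i l * (G.h e y).det) * φ.coeffBar e y l) = 0 := by
    intro i y hy hyK
    rw [hc0 e y fun h => hyK ⟨_, h, e.right_inv hy⟩]
    simp
  rw [h2, integral_finsetSum]
  · exact Finset.sum_eq_zero fun i _ =>
      setIntegral_wirt_eq_zero e.open_target (hV i) hKc hKt (hV0 i) i
  · intro i _
    have h3 : IntegrableOn (wirt i fun x => ∑ l, (-Complex.I * 2 ^ n) *
        ((G.hInv e x i l * (G.h e x).det) * φ.coeffBar e x l)) (e '' K) :=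
      ((contDiffOn_wirt e.open_target (hV i) i).continuousOn.mono hKt).integrableOn_compact hKc
    -- The target of e need not be relatively compact, so integrability comes from the compact image
    -- of K, outside of which the derivative vanishes.
    refine h3.of_forall_sdiff_eq_zero e.open_target.measurableSet fun y hy => ?_
    have h4 : (fun x => ∑ l, (-Complex.I * 2 ^ n) *
        ((G.hInv e x i l * (G.h e x).det) * φ.coeffBar e x l)) =ᶠ[nhds y] fun _ => 0 := by
      filter_upwards [(e.open_target.sdiff hKc.isClosed).mem_nhds hy] with x hx
      exact hV0 i x hx.1 hx.2
    rw [wirt_congr i h4, wirt_const]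

/-- The defect is additive in φ. Differentiating the finite sum of the ρ_i φ as a whole makes
derivatives of the ρ_i unnecessary. -/
theorem defect_eq_sum {ι : Type*} [Fintype ι] {ρ : ι → M → ℝ} (hφ : φ.IsSmooth01)
    (hρ : ∀ i, ∀ e ∈ coords n M, ContDiffOn ℝ ∞ (fun y => ρ i (e.symm y)) e.target)
    (h1 : ∀ p, ∑ i, ρ i p = 1) (he : e ∈ coords n M) (hy : y ∈ e.target) :
    G.defect φ e y = ∑ i, G.defect (φ.mulFun (ρ i)) e y := by
  have hc : ∀ x j, φ.coeffBar e x j = ∑ i, (φ.mulFun (ρ i)).coeffBar e x j := by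
    intro x j
    simp only [Form.mulFun_coeffBar, ← Finset.sum_mul]
    rw [← Complex.ofReal_sum, h1, Complex.ofReal_one, one_mul]
  have hd : ∀ k l, φ.del e y k l = ∑ i, (φ.mulFun (ρ i)).del e y k l := by
    intro k l
    simp only [Form.del, hc]
    exact wirt_sum _ _ fun i _ =>
      (hφ.mulFun (hρ i)).differentiableAt_coeffBar he hy l
  simp only [G.defect_eq he hy, ← Finset.mul_sum, Finset.sum_add_distrib]
  congr 2
  · simp only [tr, hd, Finset.mul_sum]
    rw [Finset.sum_comm]
    have h2 : ∀ l, ∑ k, ∑ i, G.hInv e y k l * (φ.mulFun (ρ i)).del e y k l =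
        ∑ i, ∑ k, G.hInv e y k l * (φ.mulFun (ρ i)).del e y k l := fun l => Finset.sum_comm
    simp only [h2]
    rw [Finset.sum_comm]
    exact Finset.sum_congr rfl fun i _ => Finset.sum_comm
  · simp only [hc, Finset.sum_mul]
    exact Finset.sum_comm

variable [T2Space M] [CompactSpace M]

theorem integrable_globalize {F : OpenPartialHomeomorph M (Cn n) → Cn n → ℂ}
    (hF : IsInvariant F) : Integrable (globalize F) G.vol := by
  have := G.vol_isLocallyFiniteMeasure
  exact hF.continuous.integrable_of_hasCompactSupport (HasCompactSupport.of_compactSpace _)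

theorem integral_defect (hφ : φ.IsSmooth01) : ∫ p, globalize (G.defect φ) p ∂G.vol = 0 := by
  obtain ⟨t, ρ, h1, hsupp, hρ⟩ := exists_partition (n := n) (M := M)
  have h2 : ∀ p, globalize (G.defect φ) p =
      ∑ i, globalize (G.defect (φ.mulFun (ρ i))) p := fun p =>
    G.defect_eq_sum hφ hρ h1 (chartAt_mem_coords p) (mem_chart_target _ p)
  simp only [h2]
  rw [integral_finsetSum]
  · refine Finset.sum_eq_zero fun i _ => G.integral_defect_of_support (hφ.mulFun (hρ i))
      (chartAt_mem_coords (i : M)) (isClosed_tsupport (ρ i)) (hsupp i) fun p hp => ?_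
    change ρ i p • φ p = 0
    rw [image_eq_zero_of_notMem_tsupport hp, zero_smul]
  · exact fun i _ => G.integrable_globalize (G.isInvariant_defect (hφ.mulFun (hρ i)))

theorem isDelStar_torsionForm : G.IsDelStar G.fund G.torsionForm := by
  refine ⟨G.torsionForm_isSmooth01, fun φ hφ => ?_⟩
  rw [← sub_eq_zero, ← G.integral_defect hφ]
  exact (integral_sub (G.integrable_globalize (G.isInvariant_inner11 hφ))
    (G.integrable_globalize (G.isInvariant_inner01 hφ G.torsionForm_isSmooth01))).symm

end Pairing

end HermitianMetric

/-! ### Complex conjugation exchanges ∂ and ∂̄. -/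

section Conjugation

set_option linter.unusedSectionVars false

variable {n : ℕ} {M : Type*} [TopologicalSpace M] [ChartedSpace (Cn n) M]
  {e : OpenPartialHomeomorph M (Cn n)} {y : Cn n} {φ : Form n M ℂ 1}

/-- The complex conjugate of a form. -/
def Form.conjForm (φ : Form n M ℂ 1) : Form n M ℂ 1 := fun p =>
  (Complex.conjCLE : ℂ →L[ℝ] ℂ).compContinuousAlternatingMap (φ p)

theorem Form.conjForm_apply (φ : Form n M ℂ 1) (p : M) (v : Fin 1 → T n p) :
    φ.conjForm p v = conj (φ p v) := rfl

theorem Form.conjForm_rep (φ : Form n M ℂ 1) (v : Fin 1 → Cn n) :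
    φ.conjForm.rep e y v = conj (φ.rep e y v) := rfl

theorem Form.conjForm_conjForm (φ : Form n M ℂ 1) : φ.conjForm.conjForm = φ := by
  funext p
  exact ContinuousAlternatingMap.ext fun v => Complex.conj_conj _

theorem Form.conjForm_coeff (φ : Form n M ℂ 1) (j : Fin n) :
    φ.conjForm.coeff e y j = conj (φ.coeffBar e y j) := by
  simp only [Form.coeff, Form.coeffBar, conjForm_rep, map_mul, map_add, map_div₀, map_one,
    map_ofNat, Complex.conj_I]
  ring

theorem Form.Smooth.conjForm (hφ : φ.Smooth) : φ.conjForm.Smooth := fun e he =>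
  contDiffOn_of_apply fun v => by
    simp only [Form.conjForm_rep]
    exact contDiffOn_conj (contDiffOn_apply (hφ e he) v)

theorem Form.IsSmooth01.conjForm (hφ : φ.IsSmooth01) : φ.conjForm.IsSmooth10 := by
  refine ⟨hφ.1.conjForm, fun p v => ?_⟩
  rw [Form.conjForm_apply, Form.conjForm_apply, hφ.2, map_neg, map_mul, Complex.conj_I, neg_mul,
    neg_neg]

theorem Form.IsSmooth10.conjForm (hφ : φ.IsSmooth10) : φ.conjForm.IsSmooth01 := by
  refine ⟨hφ.1.conjForm, fun p v => ?_⟩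
  rw [Form.conjForm_apply, Form.conjForm_apply, hφ.2, map_mul, Complex.conj_I, neg_mul]

/-- The sign comes from reordering dz̄ʲ ∧ dzⁱ as dzⁱ ∧ dz̄ʲ. -/
theorem Form.IsSmooth01.delBar_conjForm (hφ : φ.IsSmooth01) (he : e ∈ coords n M)
    (hy : y ∈ e.target) (i j : Fin n) :
    φ.conjForm.delBar e y i j = -conj (φ.del e y j i) := by
  simp only [Form.delBar, Form.conjForm_coeff]
  rw [wirtBar_conj j (hφ.differentiableAt_coeffBar he hy i)]
  rfl

end Conjugation

/-! ### Uniqueness of the adjoints and the values of ∂*ω and ∂̄*ω. -/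

namespace HermitianMetric

section Adjoints

set_option linter.unusedSectionVars false

open scoped ComplexOrder

variable {n : ℕ} {M : Type*} [TopologicalSpace M] [ChartedSpace (Cn n) M]
  [IsManifold 𝓘(ℂ, Cn n) ω M] {e e' : OpenPartialHomeomorph M (Cn n)} {y : Cn n}
  (G : HermitianMetric n M) {φ ψ α β : Form n M ℂ 1} [MeasurableSpace M]

/-- The minus sign of `delBar_conjForm` is absorbed by conjugating the factor -√-1 of
`inner11_fund`. -/
theorem l2Inner11_delBar_conjForm (hφ : φ.IsSmooth01) :
    G.l2Inner11 φ.conjForm.delBar G.fund.coeff11 = conj (G.l2Inner11 φ.del G.fund.coeff11) := by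
  rw [l2Inner11, l2Inner11, ← integral_conj]
  congr 1
  funext p
  have hc := chartAt_mem_coords (n := n) p
  have hp := mem_chart_target (Cn n) p
  rw [G.inner11_fund hc hp, G.inner11_fund hc hp, map_mul, G.tr_conj hc hp]
  have h : φ.conjForm.delBar (chartAt (Cn n) p) (chartAt (Cn n) p p) = fun k l =>
      -1 * conj (φ.del (chartAt (Cn n) p) (chartAt (Cn n) p p) l k) := by
    funext k l
    rw [hφ.delBar_conjForm hc hp, neg_one_mul]
  rw [h, tr_mul_left, map_neg, Complex.conj_I]
  ring

theorem l2Inner10_conjForm (φ ψ : Form n M ℂ 1) :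
    G.l2Inner10 φ.conjForm ψ.conjForm = conj (G.l2Inner01 φ ψ) := by
  rw [l2Inner10, l2Inner01, ← integral_conj]
  congr 1
  funext p
  have hc := chartAt_mem_coords (n := n) p
  have hp := mem_chart_target (Cn n) p
  simp only [inner10, inner01, map_sum, map_mul, Form.conjForm_coeff, Complex.conj_conj,
    G.hInv_conj hc hp]
  exact Finset.sum_comm

theorem isDelBarStar_conjForm_iff :
    G.IsDelBarStar G.fund α.conjForm ↔ G.IsDelStar G.fund α := by
  constructor
  · rintro ⟨h1, h2⟩
    refine ⟨by simpa only [Form.conjForm_conjForm] using h1.conjForm, fun φ hφ => ?_⟩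
    have h3 := h2 φ.conjForm hφ.conjForm
    rw [G.l2Inner11_delBar_conjForm hφ, l2Inner10_conjForm] at h3
    exact (starRingEnd ℂ).injective h3
  · rintro ⟨h1, h2⟩
    refine ⟨h1.conjForm, fun φ hφ => ?_⟩
    have h3 := h2 φ.conjForm hφ.conjForm
    rw [← φ.conjForm_conjForm, G.l2Inner11_delBar_conjForm hφ.conjForm, l2Inner10_conjForm, h3]

theorem inner01_self_nonneg (he : e ∈ coords n M) (hy : y ∈ e.target) (a : Fin n → ℂ) :
    0 ≤ G.inner01 e y a a ∧ (G.inner01 e y a a = 0 → a = 0) := by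
  have h1 : G.inner01 e y a a = star (star a) ⬝ᵥ ((G.h e y)⁻¹).mulVec (star a) := by
    rw [inner01, Finset.sum_comm]
    simp only [dotProduct, Matrix.mulVec, Finset.mul_sum, star_star, hInv]
    exact Finset.sum_congr rfl fun m _ => Finset.sum_congr rfl fun c _ => by
      simp only [Pi.star_apply, RCLike.star_def]
      ring
  have h2 := (G.h_posDef he hy).inv
  refine ⟨h1 ▸ h2.posSemidef.dotProduct_mulVec_nonneg (star a), fun h => ?_⟩
  by_contra ha
  exact (h2.dotProduct_mulVec_pos (star_ne_zero.2 ha)).ne' (h1 ▸ h)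

variable [BorelSpace M] [T2Space M] [CompactSpace M]

/-- Testing against γ = α - β gives (γ, γ) = 0. The integrand is continuous and nonnegative and the
volume charges every nonempty open set, so γ vanishes everywhere, not just almost everywhere. -/
theorem IsDelStar.unique (hα : G.IsDelStar G.fund α) (hβ : G.IsDelStar G.fund β) : α = β := by
  have hγ : (α.subForm β).IsSmooth01 := hα.1.subForm hβ.1
  set γ := α.subForm β
  have hinv := G.isInvariant_inner01 hγ hγ
  have h1 : ∫ p, globalize (fun e y => G.inner01 e y (γ.coeffBar e y) (γ.coeffBar e y)) p ∂G.vol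
      = 0 := by
    have h2 : ∀ p, globalize (fun e y => G.inner01 e y (γ.coeffBar e y) (γ.coeffBar e y)) p =
        globalize (fun e y => G.inner01 e y (γ.coeffBar e y) (α.coeffBar e y)) p -
        globalize (fun e y => G.inner01 e y (γ.coeffBar e y) (β.coeffBar e y)) p := by
      intro p
      simp only [globalize, inner01_eq_tr, ← tr_sub]
      refine congrArg _ (funext₂ fun k l => ?_)
      rw [← mul_sub, ← map_sub, ← Form.subForm_coeffBar]
    simp only [h2]
    rw [integral_sub (G.integrable_globalize (G.isInvariant_inner01 hγ hα.1))
      (G.integrable_globalize (G.isInvariant_inner01 hγ hβ.1)), sub_eq_zero]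
    exact (hα.2 γ hγ).symm.trans (hβ.2 γ hγ)
  set f := globalize (fun e y => G.inner01 e y (γ.coeffBar e y) (γ.coeffBar e y)) with hf
  have hpos : ∀ p, 0 ≤ f p ∧ (f p = 0 →
      γ.coeffBar (chartAt (Cn n) p) (chartAt (Cn n) p p) = 0) := fun p =>
    G.inner01_self_nonneg (chartAt_mem_coords p) (mem_chart_target _ p) _
  have hint : Integrable f G.vol := G.integrable_globalize hinv
  have h3 : ∫ p, (f p).re ∂G.vol = 0 := by
    have h4 := integral_re hint
    simp only [RCLike.re_eq_complex_re] at h4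
    rw [h4, h1, Complex.zero_re]
  have h5 : (fun p => (f p).re) =ᵐ[G.vol] 0 :=
    (integral_eq_zero_iff_of_nonneg (fun p => (Complex.le_def.1 (hpos p).1).1) hint.re).1 h3
  have := G.vol_isOpenPosMeasure
  have h6 : (fun p => (f p).re) = 0 :=
    (Continuous.ae_eq_iff_eq G.vol (Complex.continuous_re.comp hinv.continuous)
      continuous_const).1 h5
  refine hα.1.eq_of_coeffBar hβ.1 fun p j => ?_
  have h7 : f p = 0 :=
    Complex.ext (congrFun h6 p) (by simpa using (Complex.le_def.1 (hpos p).1).2.symm)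
  have h8 := congrFun ((hpos p).2 h7) j
  rw [Form.subForm_coeffBar] at h8
  exact sub_eq_zero.1 h8

/-- `delStar` picks some adjoint by choice; uniqueness identifies the pick with the torsion form. -/
theorem delStar_fund : G.delStar G.fund = G.torsionForm := by
  have hex : ∃ α, G.IsDelStar G.fund α := ⟨_, G.isDelStar_torsionForm⟩
  rw [delStar, dif_pos hex]
  exact IsDelStar.unique G hex.choose_spec G.isDelStar_torsionForm

theorem IsDelBarStar.eq_conjForm (hα : G.IsDelBarStar G.fund α) :
    α = G.torsionForm.conjForm := by
  rw [← α.conjForm_conjForm, isDelBarStar_conjForm_iff] at hα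
  rw [← IsDelStar.unique G hα G.isDelStar_torsionForm, Form.conjForm_conjForm]

theorem delBarStar_fund : G.delBarStar G.fund = G.torsionForm.conjForm := by
  have hex : ∃ α, G.IsDelBarStar G.fund α :=
    ⟨_, G.isDelBarStar_conjForm_iff.2 G.isDelStar_torsionForm⟩
  rw [delBarStar, dif_pos hex]
  exact IsDelBarStar.eq_conjForm G hex.choose_spec

theorem del_torsionForm (he : e ∈ coords n M) (hy : y ∈ e.target) (i j : Fin n) :
    G.torsionForm.del e y i j =
      wirt i (fun x => -Complex.I * conj (G.torsionTrace e x j)) y := by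
  refine wirt_congr i ?_
  filter_upwards [e.open_target.mem_nhds hy] with x hx
  exact G.torsionForm_coeffBar he hx j

end Adjoints

end HermitianMetric

end HermGeom

end

theorem propositionl3 {n : ℕ} (hn : 2 ≤ n) {M : Type*} [TopologicalSpace M] [T2Space M]
    [CompactSpace M] [ChartedSpace (HermGeom.Cn n) M]
    [IsManifold (modelWithCornersSelf ℂ (HermGeom.Cn n)) ω M]
    [MeasurableSpace M] [BorelSpace M] (G : HermGeom.HermitianMetric n M) :
    (∃! α, G.IsDelStar G.fund α) ∧ (∃! α, G.IsDelBarStar G.fund α) ∧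
    (G.IsLCK → ∀ e ∈ HermGeom.coords n M, ∀ y ∈ e.target, ∀ i j : Fin n,
      G.ricci1 e y i j - G.ricci2 e y i j =
        (1 / ((n : ℂ) - 1)) * ((G.scalHat e y - G.scal e y) * G.fund.coeff11 e y i j
          + (n : ℂ) * (G.delStar G.fund).del e y i j)) ∧
    (n = 2 → ∀ e ∈ HermGeom.coords n M, ∀ y ∈ e.target, ∀ i j : Fin n,
      G.ricci1 e y i j - G.ricci2 e y i j =
        (G.scalHat e y - G.scal e y) * G.fund.coeff11 e y i j
          + (G.delStar G.fund).del e y i j + (G.delBarStar G.fund).delBar e y i j) := by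
  refine ⟨⟨G.torsionForm, G.isDelStar_torsionForm, fun α hα =>
      HermGeom.HermitianMetric.IsDelStar.unique G hα G.isDelStar_torsionForm⟩,
    ⟨G.torsionForm.conjForm, G.isDelBarStar_conjForm_iff.2 G.isDelStar_torsionForm,
      fun α hα => HermGeom.HermitianMetric.IsDelBarStar.eq_conjForm G hα⟩, ?_, ?_⟩
  · rintro ⟨θ, hθ, h⟩ e he y hy i j
    rw [G.delStar_fund, G.del_torsionForm he hy]
    -- The functions a_i are the coefficients θ(∂/∂zⁱ). The equation dω = θ ∧ ω is used on the whole
    -- chart, dθ = 0 only at y.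
    exact G.ricci_sub_of_lck hn he hy (fun i => HermGeom.differentiableAt_realCoeff hθ he hy i)
      (fun x hx i j l => G.wirt_h_sub_of_lck he hx (h e he x hx).2 i j l)
      (fun i j => HermGeom.wirtBar_realCoeff_conj hθ he hy (h e he y hy).1 i j) i j
  · rintro rfl e he y hy i j
    rw [G.delStar_fund, G.delBarStar_fund, G.torsionForm_isSmooth01.delBar_conjForm he hy,
      G.del_torsionForm he hy, G.del_torsionForm he hy, ← sub_eq_add_neg]
    exact G.ricci_sub_of_surface he hy i j
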